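/- Let $(\mathbf U_t,Y_t)_{t\ge 0}$ be a strictly stationary sequence of random vectors in $\mathbb R^d\times\mathbb R$, with $\mathbf U_t\in\mathcal U$ and $Y_t\in\mathcal Y$ almost surely for bounded measurable sets $\mathcal U\subset\mathbb R^d$, $\mathcal Y\subset\mathbb R$. Let $D\supseteq\mathcal Y$ be a measurable subset of $\mathbb R$ (for instance $D=\mathcal Y$ or $D=\mathbb R$), let $(\phi_i)_{i\ge 0}$ be an orthonormal basis of $L^2(D)$ with $|\phi_i(y)|<M$ for some $M$ and all $i\ge0$, $y\in\mathcal Y$, and let $f(y|\mathbf u)$, $\mathbf u\in\mathcal U$, $y\in D$, be a (jointly measurable, nonnegative) conditional density of $Y_t$ given $\mathbf U_t=\mathbf u$ with respect to Lebesgue measure. Assume: 1. (Smoothness in $y$.) For every $\mathbf u\in\mathcal U$ there are $s(\mathbf u)$ and $c(\mathbf u)>0$ such that $f(\cdot|\mathbf u)=\sum_{i\ge0}\beta_i(\mathbf u)\phi_i$ in $L^2(D)$ with $\sum_{i\ge1}(\pi i)^{2s(\mathbf u)}\beta_i(\mathbf u)^2\le c(\mathbf u)^2$, where $\inf_{\mathbf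 u\in\mathcal U}s(\mathbf u)=\gamma>\tfrac12$ and $\mathbb E[c(\mathbf U_0)^2]<\infty$. 2. (Smoothness in $\mathbf u$.) There is $M_0>0$ with $|f(y|\mathbf u_1)-f(y|\mathbf u_2)|\le M_0\|\mathbf u_1-\mathbf u_2\|_2$ for all $y\in\mathcal Y$ and $\mathbf u_1,\mathbf u_2\in\mathcal U$. 3. (Bounded densities.) There are constants $0<m\le M'<\infty$ such that $\mathbf U_0$ has a Lebesgue density on $\mathcal U$ with values in $[m,M']$ and, for every $j\ge1$ and $\mathbf u\in\mathcal U$, so has the conditional distribution of $\mathbf U_j$ given $\mathbf U_0=\mathbf u$. 4. (Geometric strong mixing.) There is $\rho\in(0,1)$ with $\alpha(k)=O(\rho^k)$, where $\alpha(k)$ is the supremum of $|\mathbb P(A\cap B)-\mathbb P(A)\mathbb P(B)|$ over $n\ge0$, $A\in\sigma\{(\mathbf U_i,Y_i):i\le n\}$ and $B\in\sigma\{(\mathbf U_i,Y_i):i\ge n+k\}$. For bandwidths $\delta_T>0$ and cutoffs $I=I_T\in\mathbb N$ let $$\hat\beta_i(\mathbf u)=\frac{\sum_{j=1}^T\mathbb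 I(\|\mathbf U_j-\mathbf u\|_2\le\delta_T)\,\phi_i(Y_j)}{\sum_{j=1}^T\mathbb I(\|\mathbf U_j-\mathbf u\|_2\le\delta_T)}\quad(\text{with }0/0:=0),\qquad \hat f_I(y|\mathbf u)=\sum_{i=0}^{I}\hat\beta_i(\mathbf u)\phi_i(y).$$ If $\delta_T\sim T^{-\frac1{2+d}}$ and $I\sim T^{\frac{2}{(2\gamma+1)(2+d)}}$, where $a_T\sim b_T$ means that $a_T/b_T$ is bounded away from zero and infinity for all large $T$, then, with $\mathbb P_{\mathbf U}$ the law of $\mathbf U_0$, $$\int\!\!\int_D\big(\hat f_I(y|\mathbf u)-f(y|\mathbf u)\big)^2\,dy\,d\mathbb P_{\mathbf U}(\mathbf u)=O_P\Big(T^{\frac{-2\gamma}{2\gamma+1+d(\gamma+\frac12)}}\Big)\qquad(T\to\infty).$$ -/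

import Mathlib

open MeasureTheory Filter Asymptotics
open scoped ENNReal Topology

noncomputable section

namespace FlexCodeTS

/-- `φ 0, φ 1, …` are (measurable representatives of) an orthonormal basis of the real Hilbert
space `L²(D)`, where `D ⊆ ℝ` carries Lebesgue measure. -/
def IsOrthonormalBasisL2 (D : Set ℝ) (φ : ℕ → ℝ → ℝ) : Prop :=
  (∀ i, Measurable (φ i)) ∧
    ∃ b : HilbertBasis ℕ ℝ (Lp ℝ 2 (volume.restrict D)),
      ∀ i, (b i : ℝ → ℝ) =ᵐ[volume.restrict D] φ i

/-- The Sobolev class `W_φ(s, c)`: functions `g = ∑ i, b i • φ i` (convergence in `L²(D)`) with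
`∑_{i ≥ 1} (π i)^(2 s) (b i)² ≤ c²`. The coefficient of `φ 0` is unrestricted. -/
def sobolevClass (D : Set ℝ) (φ : ℕ → ℝ → ℝ) (s c : ℝ) : Set (ℝ → ℝ) :=
  {g | MemLp g 2 (volume.restrict D) ∧
    ∃ b : ℕ → ℝ,
      Tendsto (fun n : ℕ =>
          eLpNorm (fun y => g y - ∑ i ∈ Finset.range n, b i * φ i y) 2 (volume.restrict D))
        atTop (𝓝 0) ∧
      ∑' i : ℕ, ENNReal.ofReal ((Real.pi * ((i : ℝ) + 1)) ^ (2 * s) * b (i + 1) ^ 2)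
        ≤ ENNReal.ofReal (c ^ 2)}

section Series

variable {Ω : Type*} [MeasurableSpace Ω] {S : Type*} [MeasurableSpace S]

/-- Strict stationarity: the law of the whole sequence is invariant under every time shift. -/
def IsStationary (μ : Measure Ω) (Z : ℕ → Ω → S) : Prop :=
  ∀ k : ℕ, μ.map (fun ω (i : ℕ) => Z (i + k) ω) = μ.map (fun ω (i : ℕ) => Z i ω)

/-- The σ-field generated by `Z i`, `i ≤ n`. -/
@[reducible] def pastSigma (Z : ℕ → Ω → S) (n : ℕ) : MeasurableSpace Ω :=
  ⨆ i : ℕ, ⨆ _ : i ≤ n, MeasurableSpace.comap (Z i) inferInstance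

/-- The σ-field generated by `Z i`, `i ≥ n`. -/
@[reducible] def futureSigma (Z : ℕ → Ω → S) (n : ℕ) : MeasurableSpace Ω :=
  ⨆ i : ℕ, ⨆ _ : n ≤ i, MeasurableSpace.comap (Z i) inferInstance

/-- The strong mixing coefficient `α(k)` of a sequence indexed by `ℕ`: the supremum of
`|P(A ∩ B) - P(A) P(B)|` over all times `n`, all `A` in the σ-field of the times `≤ n` and all `B`
in the σ-field of the times `≥ n + k`. For a stationary sequence this is the coefficient with
`n = 0` of its extension to a stationary sequence indexed by `ℤ`. -/
def alphaMixingCoeff (μ : Measure Ω) (Z : ℕ → Ω → S) (k : ℕ) : ℝ :=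
  sSup {x : ℝ | ∃ (n : ℕ) (A B : Set Ω),
    MeasurableSet[pastSigma Z n] A ∧ MeasurableSet[futureSigma Z (n + k)] B ∧
      x = |μ.real (A ∩ B) - μ.real A * μ.real B|}

/-- Geometric strong mixing: `α(k) = O(ρ ^ k)` for some `ρ ∈ (0, 1)`. -/
def IsGeometricallyAlphaMixing (μ : Measure Ω) (Z : ℕ → Ω → S) : Prop :=
  ∃ ρ : ℝ, 0 < ρ ∧ ρ < 1 ∧ (alphaMixingCoeff μ Z) =O[atTop] (fun k : ℕ => ρ ^ k)

/-- `X T = O_P(a T)` as `T → ∞`, for `X T` with values in `[0, ∞]`. -/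
def IsBigOP (μ : Measure Ω) (X : ℕ → Ω → ℝ≥0∞) (a : ℕ → ℝ) : Prop :=
  ∀ ε : ℝ, 0 < ε → ∃ M : ℝ, 0 < M ∧
    ∀ᶠ T in atTop, μ {ω | ENNReal.ofReal (M * a T) < X T ω} ≤ ENNReal.ofReal ε

end Series

section Model

variable {Ω : Type*} [MeasurableSpace Ω] {d : ℕ}

/-- `f u y` is a version of the conditional density (with respect to Lebesgue measure on `D`)
of `Y` given `U = u`, where `u` ranges over `K`. -/
def IsCondDensity (μ : Measure Ω) (U : Ω → EuclideanSpace ℝ (Fin d)) (Y : Ω → ℝ)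
    (K : Set (EuclideanSpace ℝ (Fin d))) (D : Set ℝ)
    (f : EuclideanSpace ℝ (Fin d) → ℝ → ℝ) : Prop :=
  Measurable (Function.uncurry f) ∧ (∀ u ∈ K, ∀ y ∈ D, 0 ≤ f u y) ∧
    μ.map (fun ω => (U ω, Y ω)) =
      ((μ.map U).prod (volume.restrict D)).withDensity (fun p => ENNReal.ofReal (f p.1 p.2))

/-- Smoothness in the `y` direction: `f(· | u) ∈ W_φ(s(u), c(u))` for every `u ∈ K`, where
`inf_u s(u) = γ > 1/2` and `E[c(U)²] < ∞`. -/
def SmoothInY (μ : Measure Ω) (U : Ω → EuclideanSpace ℝ (Fin d))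
    (K : Set (EuclideanSpace ℝ (Fin d))) (D : Set ℝ) (φ : ℕ → ℝ → ℝ)
    (f : EuclideanSpace ℝ (Fin d) → ℝ → ℝ) (γ : ℝ) : Prop :=
  1 / 2 < γ ∧ ∃ s c : EuclideanSpace ℝ (Fin d) → ℝ,
    IsGLB (s '' K) γ ∧ (∀ u ∈ K, 0 < c u) ∧
    Integrable (fun u => c u ^ 2) (μ.map U) ∧
    ∀ u ∈ K, f u ∈ sobolevClass D φ (s u) (c u)

/-- Smoothness in the `u` direction: `u ↦ f(y | u)` is Lipschitz on `K`, with the same constant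
for all `y` in `𝒴`. -/
def SmoothInU (K : Set (EuclideanSpace ℝ (Fin d))) (𝒴 : Set ℝ)
    (f : EuclideanSpace ℝ (Fin d) → ℝ → ℝ) : Prop :=
  ∃ M₀ : ℝ, 0 < M₀ ∧ ∀ y ∈ 𝒴, ∀ u₁ ∈ K, ∀ u₂ ∈ K, |f u₁ y - f u₂ y| ≤ M₀ * ‖u₁ - u₂‖

/-- `U 0` has a Lebesgue density on `K` that is bounded away from zero and infinity on `K`, and so
has, uniformly in `j ≥ 1` and in `u ∈ K`, the conditional distribution of `U j` given
`U 0 = u`. -/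
def HasBoundedDensities (μ : Measure Ω) (U : ℕ → Ω → EuclideanSpace ℝ (Fin d))
    (K : Set (EuclideanSpace ℝ (Fin d))) : Prop :=
  ∃ m M : ℝ, 0 < m ∧
    (∃ g : EuclideanSpace ℝ (Fin d) → ℝ, Measurable g ∧ (∀ u ∈ K, m ≤ g u ∧ g u ≤ M) ∧
      μ.map (U 0) = (volume.restrict K).withDensity (fun u => ENNReal.ofReal (g u))) ∧
    ∀ j : ℕ, 1 ≤ j →
      ∃ h : EuclideanSpace ℝ (Fin d) → EuclideanSpace ℝ (Fin d) → ℝ,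
        Measurable (Function.uncurry h) ∧
        (∀ u ∈ K, ∀ v ∈ K, m ≤ h u v ∧ h u v ≤ M) ∧
        μ.map (fun ω => (U 0 ω, U j ω)) =
          ((μ.map (U 0)).prod (volume.restrict K)).withDensity
            (fun p => ENNReal.ofReal (h p.1 p.2))

open Classical in
/-- The Nadaraya–Watson estimate of `β_i(u)` with uniform kernel and bandwidth `δ` from the data
`(u 1, y 1), …, (u T, y T)` (its value is `0` if no `u j` lies within `δ` of `v`). -/
def nwEstimate (φ : ℕ → ℝ → ℝ) (δ : ℝ) (T : ℕ) (u : ℕ → EuclideanSpace ℝ (Fin d)) (y : ℕ → ℝ)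
    (i : ℕ) (v : EuclideanSpace ℝ (Fin d)) : ℝ :=
  (∑ j ∈ Finset.Icc 1 T, (if ‖u j - v‖ ≤ δ then 1 else 0) * φ i (y j)) /
    (∑ j ∈ Finset.Icc 1 T, (if ‖u j - v‖ ≤ δ then 1 else 0))

/-- The FlexCodeTS estimate `∑_{i = 0}^I β̂_i(v) φ_i(z)` of `f(z | v)` built on the
Nadaraya–Watson estimates. -/
def flexCodeEstimate (φ : ℕ → ℝ → ℝ) (δ : ℝ) (I T : ℕ) (u : ℕ → EuclideanSpace ℝ (Fin d))
    (y : ℕ → ℝ) (v : EuclideanSpace ℝ (Fin d)) (z : ℝ) : ℝ :=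
  ∑ i ∈ Finset.range (I + 1), nwEstimate φ δ T u y i v * φ i z

/-- The CDE loss `∬ (fhat(y|u) - f(y|u))² dy dP(u)` with `y` ranging over `D`. -/
def cdeLoss (P : Measure (EuclideanSpace ℝ (Fin d))) (D : Set ℝ)
    (fhat f : EuclideanSpace ℝ (Fin d) → ℝ → ℝ) : ℝ≥0∞ :=
  ∫⁻ u, ∫⁻ y in D, ENNReal.ofReal ((fhat u y - f u y) ^ 2) ∂volume ∂P

end Model

end FlexCodeTS

end

/-! The expected loss is bounded and Markov's inequality turns this into `O_P`. By Parseval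
(`lintegral_sq_sub_le`) the loss at `u` is at most the sum over `i ≤ I` of the squared errors of the
estimated coefficients, plus a tail of at most `(π (I + 1)) ^ (-2γ) * c u ^ 2`.

Each coefficient is the conditional mean of a bounded function of `Y`, Lipschitz in `u` with a
constant `L` not depending on `i`, so local averaging has squared bias of order `δ ^ 2`. For the
variance, let `q` be the probability of the ball around `v`. Covariances at lag `k` of functions
supported in that ball are `O(q r ^ k)` (`abs_covariance_comp_le`): bounded densities give `O(q ^
2)`, mixing gives `O(r ^ (2 k))`, and the smaller of `q ^ 2` and `r ^ (2 k)` is at most `q r ^ k`.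
Sums over `T` times thus have variance `O(T q)`, with no logarithmic loss, and the mean squared
error at `v` is `O(δ ^ 2 + 1 / (T q))` (`lintegral_sq_nwEstimate_sub_le`).

The balls need no individual lower bound on `q`, hence `K` no regular boundary: the integral of `1 /
q` over `v` is `O(δ ^ (-d))` by a Fubini argument (`lintegral_inv_measure_closedBall_le`).
Altogether the expected loss is of order `I (δ ^ 2 + δ ^ (-d) / T) + I ^ (-2γ)`, and the chosen `δ`
and `I` make the three terms equal in order. -/

noncomputable section

namespace FlexCodeTS

open ProbabilityTheory

/-! ### Covariance inequalities under strong mixing. -/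

section Mixing

variable {Ω : Type*}

/-- If two finite measures of the upper level sets of a `[0, 1]`-valued function are uniformly
close, then so are its integrals. -/
lemma abs_integral_sub_integral_le [MeasurableSpace Ω] {ν₁ ν₂ : Measure Ω} [IsFiniteMeasure ν₁] [IsFiniteMeasure ν₂]
    {X : Ω → ℝ} (hX : Measurable X) (h0 : ∀ ω, 0 ≤ X ω) (h1 : ∀ ω, X ω ≤ 1) {a : ℝ}
    (h : ∀ t : ℝ, |ν₁.real {ω | t ≤ X ω} - ν₂.real {ω | t ≤ X ω}| ≤ a) :
    |∫ ω, X ω ∂ν₁ - ∫ ω, X ω ∂ν₂| ≤ a := by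
  have hint : ∀ ν : Measure Ω, IsFiniteMeasure ν → Integrable X ν := fun ν _ =>
    Integrable.of_bound hX.aestronglyMeasurable 1
      (ae_of_all _ fun ω => by rw [Real.norm_eq_abs, abs_of_nonneg (h0 ω)]; exact h1 ω)
  have htail : ∀ ν : Measure Ω, IsFiniteMeasure ν →
      IntegrableOn (fun t : ℝ => ν.real {ω | t ≤ X ω}) (Set.Ioc 0 1) volume := by
    intro ν _
    refine Measure.integrableOn_of_bounded (M := ν.real Set.univ) (by simp) ?_ ?_
    · have : Antitone fun t : ℝ => ν.real {ω | t ≤ X ω} := fun s t hst =>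
        measureReal_mono fun ω hω => le_trans hst hω
      exact this.measurable.aestronglyMeasurable
    · refine ae_of_all _ fun t => ?_
      rw [Real.norm_eq_abs, abs_of_nonneg measureReal_nonneg]
      exact measureReal_mono (Set.subset_univ _)
  -- Layer cake: each integral is the integral over `t ∈ (0, 1]` of the mass of `{t ≤ X}`.
  rw [(hint ν₁ inferInstance).integral_eq_integral_Ioc_meas_le (ae_of_all _ h0) (ae_of_all _ h1),
    (hint ν₂ inferInstance).integral_eq_integral_Ioc_meas_le (ae_of_all _ h0) (ae_of_all _ h1),
    ← integral_sub (htail ν₁ inferInstance) (htail ν₂ inferInstance), ← Real.norm_eq_abs]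
  have := norm_setIntegral_le_of_norm_le_const (μ := volume) (s := Set.Ioc (0 : ℝ) 1) (C := a)
    (f := fun t => ν₁.real {ω | t ≤ X ω} - ν₂.real {ω | t ≤ X ω}) (by simp)
    (fun t _ => by rw [Real.norm_eq_abs]; exact h t)
  simpa using this

lemma memLp_two_of_abs_le [MeasurableSpace Ω] {μ : Measure Ω} [IsProbabilityMeasure μ] {X : Ω → ℝ} (hX : Measurable X) {G : ℝ} (h : ∀ ω, |X ω| ≤ G) :
    MemLp X 2 μ :=
  MemLp.of_bound hX.aestronglyMeasurable G (ae_of_all _ h)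

/-- Covariance inequality for `[0, 1]`-valued variables. -/
lemma abs_covariance_le_of_unitInterval {m₁ m₂ : MeasurableSpace Ω} {mΩ : MeasurableSpace Ω}
    {μ : Measure Ω} [IsProbabilityMeasure μ] (hm₁ : m₁ ≤ mΩ)
    (hm₂ : m₂ ≤ mΩ) {a : ℝ}
    (ha : ∀ A B : Set Ω, MeasurableSet[m₁] A → MeasurableSet[m₂] B →
      |μ.real (A ∩ B) - μ.real A * μ.real B| ≤ a)
    {X Y : Ω → ℝ} (hX : Measurable[m₁] X) (hY : Measurable[m₂] Y)
    (hX0 : ∀ ω, 0 ≤ X ω) (hX1 : ∀ ω, X ω ≤ 1) (hY0 : ∀ ω, 0 ≤ Y ω) (hY1 : ∀ ω, Y ω ≤ 1) :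
    |cov[X, Y; μ]| ≤ a := by
  have hX' : Measurable X := hX.mono hm₁ le_rfl
  have hY' : Measurable Y := hY.mono hm₂ le_rfl
  have hXm : MemLp X 2 μ := memLp_two_of_abs_le hX' (G := 1)
    fun ω => by rw [abs_of_nonneg (hX0 ω)]; exact hX1 ω
  have hYm : MemLp Y 2 μ := memLp_two_of_abs_le hY' (G := 1)
    fun ω => by rw [abs_of_nonneg (hY0 ω)]; exact hY1 ω
  have hXint : Integrable X μ := hXm.integrable one_le_two
  have hEX : 0 ≤ ∫ ω, X ω ∂μ := integral_nonneg hX0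
  -- The layer cake comparison is used twice: here for `X`, between `μ` restricted to `B` and `μ B •
  -- μ`, then for `Y`, between the measure with density `X` and `E[X] • μ`.
  have step : ∀ B, MeasurableSet[m₂] B → |∫ ω in B, X ω ∂μ - μ.real B * ∫ ω, X ω ∂μ| ≤ a := by
    intro B hB
    have key := abs_integral_sub_integral_le (ν₁ := μ.restrict B)
      (ν₂ := (μ.real B).toNNReal • μ) hX' hX0 hX1 (a := a) (fun t => by
        have hA : MeasurableSet[m₁] {ω | t ≤ X ω} := hX (measurableSet_Ici (a := t))
        rw [measureReal_restrict_apply (hm₁ _ hA), measureReal_nnreal_smul_apply,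
          Real.coe_toNNReal _ measureReal_nonneg, mul_comm (μ.real B)]
        exact ha _ _ hA hB)
    rwa [integral_smul_nnreal_measure, NNReal.smul_def, Real.coe_toNNReal _ measureReal_nonneg,
      smul_eq_mul] at key
  have hXd : ∫⁻ ω, ENNReal.ofReal (X ω) ∂μ ≠ ∞ := hXint.lintegral_lt_top.ne
  have hfin : IsFiniteMeasure (μ.withDensity fun ω => ENNReal.ofReal (X ω)) :=
    isFiniteMeasure_withDensity hXd
  have key := abs_integral_sub_integral_le (ν₁ := μ.withDensity fun ω => ENNReal.ofReal (X ω))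
    (ν₂ := (∫ ω, X ω ∂μ).toNNReal • μ) hY' hY0 hY1 (a := a) (fun t => by
      have hB : MeasurableSet[m₂] {ω | t ≤ Y ω} := hY (measurableSet_Ici (a := t))
      have : (μ.withDensity fun ω => ENNReal.ofReal (X ω)).real {ω | t ≤ Y ω}
          = ∫ ω in {ω | t ≤ Y ω}, X ω ∂μ := by
        rw [measureReal_def, withDensity_apply _ (hm₂ _ hB),
          integral_eq_lintegral_of_nonneg_ae (ae_of_all _ hX0) hX'.aestronglyMeasurable]
      rw [this, measureReal_nnreal_smul_apply, Real.coe_toNNReal _ hEX, mul_comm]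
      exact step _ hB)
  rw [integral_smul_nnreal_measure, NNReal.smul_def, Real.coe_toNNReal _ hEX, smul_eq_mul,
    integral_withDensity_eq_integral_toReal_smul hX'.ennreal_ofReal
      (ae_of_all _ fun _ => ENNReal.ofReal_lt_top)] at key
  rw [covariance_eq_sub hXm hYm]
  convert key using 3
  refine integral_congr_ae (ae_of_all _ fun ω => ?_)
  simp [ENNReal.toReal_ofReal (hX0 ω)]

/-- Covariance inequality for bounded variables. -/
lemma abs_covariance_le_of_bounded {m₁ m₂ : MeasurableSpace Ω} {mΩ : MeasurableSpace Ω}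
    {μ : Measure Ω} [IsProbabilityMeasure μ] (hm₁ : m₁ ≤ mΩ)
    (hm₂ : m₂ ≤ mΩ) {a : ℝ}
    (ha : ∀ A B : Set Ω, MeasurableSet[m₁] A → MeasurableSet[m₂] B →
      |μ.real (A ∩ B) - μ.real A * μ.real B| ≤ a)
    {X Y : Ω → ℝ} (hX : Measurable[m₁] X) (hY : Measurable[m₂] Y) {G : ℝ} (hG : 0 < G)
    (hXG : ∀ ω, |X ω| ≤ G) (hYG : ∀ ω, |Y ω| ≤ G) :
    |cov[X, Y; μ]| ≤ 4 * G ^ 2 * a := by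
  -- The affine map `x ↦ (x + G) / (2 G)` carries `[-G, G]` onto `[0, 1]` and divides covariances by
  -- `4 G ^ 2`.
  have hb : ∀ x : ℝ, |x| ≤ G → 0 ≤ (2 * G)⁻¹ * (x + G) ∧ (2 * G)⁻¹ * (x + G) ≤ 1 := by
    intro x hx
    have := abs_le.1 hx
    refine ⟨by have : 0 ≤ x + G := by linarith
               positivity, ?_⟩
    rw [inv_mul_le_iff₀ (by positivity)]
    linarith
  have h := abs_covariance_le_of_unitInterval hm₁ hm₂ ha
    (X := fun ω => (2 * G)⁻¹ * (X ω + G)) (Y := fun ω => (2 * G)⁻¹ * (Y ω + G))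
    (((measurable_id.add_const G).const_mul (2 * G)⁻¹).comp hX)
    (((measurable_id.add_const G).const_mul (2 * G)⁻¹).comp hY)
    (fun ω => (hb _ (hXG ω)).1) (fun ω => (hb _ (hXG ω)).2)
    (fun ω => (hb _ (hYG ω)).1) (fun ω => (hb _ (hYG ω)).2)
  have hXi : Integrable X μ :=
    (memLp_two_of_abs_le (hX.mono hm₁ le_rfl) hXG).integrable one_le_two
  have hYi : Integrable Y μ :=
    (memLp_two_of_abs_le (hY.mono hm₂ le_rfl) hYG).integrable one_le_two
  rw [covariance_const_mul_left, covariance_const_mul_right, covariance_add_const_left hXi,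
    covariance_add_const_right hYi, abs_mul, abs_mul, abs_of_pos (by positivity)] at h
  have h2 := mul_le_mul_of_nonneg_left h (by positivity : 0 ≤ 4 * G ^ 2)
  refine le_trans (le_of_eq ?_) h2
  field_simp
  ring

end Mixing

/-! ### Geometric sums and the variance of a weakly dependent sum. -/

section Sums

lemma sum_pow_comp_le {r : ℝ} (hr0 : 0 < r) (hr1 : r < 1) {s : Finset ℕ} {g : ℕ → ℕ}
    (hg : Set.InjOn g s) : ∑ k ∈ s, r ^ g k ≤ (1 - r)⁻¹ := by
  rw [← Finset.sum_image (f := fun k => r ^ k) hg, ← tsum_geometric_of_lt_one hr0.le hr1]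
  exact (summable_geometric_of_lt_one hr0.le hr1).sum_le_tsum _ fun _ _ => by positivity

/-- On either side of `j` the distance to `j` is injective, so each side is dominated by one
geometric series. -/
lemma sum_pow_dist_le {r : ℝ} (hr0 : 0 < r) (hr1 : r < 1) (T j : ℕ) :
    ∑ k ∈ Finset.Icc 1 T, r ^ (Nat.dist j k) ≤ 2 / (1 - r) := by
  rw [← Finset.sum_filter_add_sum_filter_not _ (fun k => j ≤ k)]
  have h1 := sum_pow_comp_le hr0 hr1 (s := (Finset.Icc 1 T).filter (fun k => j ≤ k))
    (g := fun k => Nat.dist j k) (fun k hk l hl h => by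
      have hk := (Finset.mem_filter.1 hk).2
      have hl := (Finset.mem_filter.1 hl).2
      simp only [Nat.dist_eq_sub_of_le hk, Nat.dist_eq_sub_of_le hl] at h
      omega)
  have h2 := sum_pow_comp_le hr0 hr1 (s := (Finset.Icc 1 T).filter (fun k => ¬ j ≤ k))
    (g := fun k => Nat.dist j k) (fun k hk l hl h => by
      have hk := (not_le.1 (Finset.mem_filter.1 hk).2).le
      have hl := (not_le.1 (Finset.mem_filter.1 hl).2).le
      simp only [Nat.dist_eq_sub_of_le_right hk, Nat.dist_eq_sub_of_le_right hl] at h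
      omega)
  rw [div_eq_mul_inv]
  linarith

variable {Ω : Type*} [MeasurableSpace Ω] {μ : Measure Ω} [IsProbabilityMeasure μ]

/-- Variance of a sum of variables with geometrically decaying covariances. -/
lemma variance_sum_le {X : ℕ → Ω → ℝ} (hX : ∀ i, MemLp (X i) 2 μ) {A r : ℝ} (hA : 0 ≤ A)
    (hr0 : 0 < r) (hr1 : r < 1) (h : ∀ j k, |cov[X j, X (j + k); μ]| ≤ A * r ^ k) (T : ℕ) :
    Var[fun ω => ∑ j ∈ Finset.Icc 1 T, X j ω; μ] ≤ A * (2 / (1 - r)) * T := by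
  have hjk : ∀ j k, cov[X j, X k; μ] ≤ A * r ^ (Nat.dist j k) := by
    intro j k
    rcases le_total j k with hle | hle
    · rw [Nat.dist_eq_sub_of_le hle]
      simpa [Nat.add_sub_cancel' hle] using (le_abs_self _).trans (h j (k - j))
    · rw [Nat.dist_eq_sub_of_le_right hle, covariance_comm]
      simpa [Nat.add_sub_cancel' hle] using (le_abs_self _).trans (h k (j - k))
  rw [variance_fun_sum' fun i _ => hX i]
  calc ∑ j ∈ Finset.Icc 1 T, ∑ k ∈ Finset.Icc 1 T, cov[X j, X k; μ]
      ≤ ∑ j ∈ Finset.Icc 1 T, A * (2 / (1 - r)) := by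
        refine Finset.sum_le_sum fun j _ => ?_
        refine (Finset.sum_le_sum fun k _ => hjk j k).trans ?_
        rw [← Finset.mul_sum]
        exact mul_le_mul_of_nonneg_left (sum_pow_dist_le hr0 hr1 T j) hA
    _ = A * (2 / (1 - r)) * T := by simp [mul_comm]

end Sums

/-! ### Integrating the reciprocal mass of a ball. -/

section Balls

/-- The integral of the reciprocal mass of balls is controlled by a volume ratio. -/
lemma lintegral_inv_measure_closedBall_le {E : Type*} [NormedAddCommGroup E]
    [MeasurableSpace E] [BorelSpace E] [SecondCountableTopology E]
    (vol : Measure E) [SFinite vol] [vol.IsAddHaarMeasure]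
    (P : Measure E) [IsProbabilityMeasure P] {K : Set E} (hK : ∀ᵐ u ∂P, u ∈ K) {ε R : ℝ}
    (hεR : ε ≤ R)
    (hpos : vol (Metric.closedBall 0 ε) ≠ 0) (hfin : vol (Metric.closedBall 0 ε) ≠ ∞) :
    ∫⁻ u, (P (Metric.closedBall u (2 * ε)))⁻¹ ∂P
      ≤ vol (Metric.cthickening R K) / vol (Metric.closedBall 0 ε) := by
  have hdist : ∀ ε : ℝ, MeasurableSet {z : E × E | dist z.1 z.2 ≤ ε} := fun ε =>
    measurableSet_le measurable_dist measurable_const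
  have hball : Measurable fun u => P (Metric.closedBall u (2 * ε)) := by
    have := measurable_measure_prodMk_left (ν := P) (hdist (2 * ε))
    convert this using 3 with u
    ext x
    simp [dist_comm]
  have hvol : ∀ u : E, vol (Metric.closedBall u ε) = vol (Metric.closedBall 0 ε) := fun u => by
    have := measure_preimage_add vol u (Metric.closedBall u ε)
    rw [← this]
    congr 1
    ext x
    simp [dist_eq_norm]
  rw [ENNReal.le_div_iff_mul_le (Or.inl hpos) (Or.inl hfin),
    ← lintegral_mul_const _ (by exact hball.inv)]
  -- The volume of a ball of radius `ε` is written as an integral over its points `x`, so that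
  -- Tonelli allows integrating over `u` first.
  calc ∫⁻ u, (P (Metric.closedBall u (2 * ε)))⁻¹ * vol (Metric.closedBall 0 ε) ∂P
      = ∫⁻ u, ∫⁻ x, Set.indicator {z : E × E | dist z.1 z.2 ≤ ε}
          (fun z => (P (Metric.closedBall z.1 (2 * ε)))⁻¹) (u, x) ∂vol ∂P := by
        refine lintegral_congr fun u => ?_
        rw [← hvol u, ← lintegral_indicator_const Metric.isClosed_closedBall.measurableSet]
        refine lintegral_congr fun x => ?_
        by_cases hx : dist u x ≤ ε
        · rw [Set.indicator_of_mem (by rwa [Metric.mem_closedBall']),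
            Set.indicator_of_mem (by exact hx)]
        · rw [Set.indicator_of_notMem (by rwa [Metric.mem_closedBall']),
            Set.indicator_of_notMem (by exact hx)]
    _ = ∫⁻ x, ∫⁻ u, Set.indicator {z : E × E | dist z.1 z.2 ≤ ε}
          (fun z => (P (Metric.closedBall z.1 (2 * ε)))⁻¹) (u, x) ∂P ∂vol :=
        lintegral_lintegral_swap
          (((hball.comp measurable_fst).inv.indicator (hdist ε)).aemeasurable)
    _ ≤ ∫⁻ x, Set.indicator (Metric.cthickening R K) 1 x ∂vol := by
        refine lintegral_mono fun x => ?_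
        by_cases hx : x ∈ Metric.cthickening R K
        · rw [Set.indicator_of_mem hx]
          calc ∫⁻ u, Set.indicator {z : E × E | dist z.1 z.2 ≤ ε}
                (fun z => (P (Metric.closedBall z.1 (2 * ε)))⁻¹) (u, x) ∂P
              ≤ ∫⁻ u, Set.indicator (Metric.closedBall x ε)
                  (fun _ => (P (Metric.closedBall x ε))⁻¹) u ∂P := by
                refine lintegral_mono fun u => ?_
                by_cases hu : dist u x ≤ ε
                · rw [Set.indicator_of_mem (by exact hu), Set.indicator_of_mem (by exact hu)]
                  -- If `u` is within `ε` of `x`, the ball of radius `2 ε` at `u` contains the ball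
                  -- of radius `ε` at `x`.
                  refine ENNReal.inv_le_inv.2 (measure_mono fun v hv => ?_)
                  rw [Metric.mem_closedBall] at hv ⊢
                  calc dist v u ≤ dist v x + dist u x := dist_triangle_right _ _ _
                    _ ≤ 2 * ε := by linarith
                · rw [Set.indicator_of_notMem (by exact hu)]
                  exact zero_le
            _ ≤ 1 := by
                -- A ball of mass zero is covered too, since `∞ * 0 = 0`.
                rw [lintegral_indicator_const Metric.isClosed_closedBall.measurableSet]
                exact ENNReal.inv_mul_le_one _
        · rw [Set.indicator_of_notMem hx]
          -- Outside the thickening no point of `K` lies within `ε ≤ R` of `x`, and `P` lives on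
          -- `K`.
          refine le_of_eq ?_
          rw [lintegral_eq_zero_iff' ?_]
          · filter_upwards [hK] with u hu
            refine Set.indicator_of_notMem (s := {z : E × E | dist z.1 z.2 ≤ ε})
              (fun h : dist u x ≤ ε => hx ?_) _
            exact Metric.mem_cthickening_of_dist_le x u R K hu (by rw [dist_comm]; linarith)
          · exact (((hball.comp measurable_fst).inv.indicator (hdist ε)).comp
              measurable_prodMk_right).aemeasurable
    _ = vol (Metric.cthickening R K) := by
        rw [lintegral_indicator_one Metric.isClosed_cthickening.measurableSet]

end Balls

end FlexCodeTS

namespace FlexCodeTS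

/-! ### Parseval and the truncation error of the orthogonal series. -/

section L2

variable {D : Set ℝ} {φ : ℕ → ℝ → ℝ}

lemma lintegral_ofReal_sq_eq (g : Lp ℝ 2 (volume.restrict D)) {h : ℝ → ℝ}
    (hg : (g : ℝ → ℝ) =ᵐ[volume.restrict D] h) :
    ∫⁻ y in D, ENNReal.ofReal (h y ^ 2) = ENNReal.ofReal (‖g‖ ^ 2) := by
  rw [← real_inner_self_eq_norm_sq, L2.inner_def, ofReal_integral_eq_lintegral_ofReal
    (L2.integrable_inner g g) (ae_of_all _ fun y => real_inner_self_nonneg)]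
  refine lintegral_congr_ae ?_
  filter_upwards [hg] with y hy
  rw [← hy, real_inner_self_eq_norm_sq, Real.norm_eq_abs, sq_abs]

/-- Tail sums of squared coefficients under a Sobolev constraint. -/
lemma tsum_ofReal_sq_le {β : ℕ → ℝ} {s c γ : ℝ} (hγ : 0 < γ) (hs : γ ≤ s)
    (hβ : ∑' i : ℕ, ENNReal.ofReal ((Real.pi * ((i : ℝ) + 1)) ^ (2 * s) * β (i + 1) ^ 2)
      ≤ ENNReal.ofReal (c ^ 2)) (I : ℕ) :
    ∑' i, ENNReal.ofReal (β (i + I + 1) ^ 2)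
      ≤ ENNReal.ofReal ((Real.pi * ((I : ℝ) + 1)) ^ (-(2 * γ))) * ENNReal.ofReal (c ^ 2) :=
  calc ∑' i, ENNReal.ofReal (β (i + I + 1) ^ 2)
      ≤ ∑' i : ℕ, ENNReal.ofReal ((Real.pi * ((I : ℝ) + 1)) ^ (-(2 * γ))) *
          ENNReal.ofReal ((Real.pi * (((i + I : ℕ) : ℝ) + 1)) ^ (2 * s) * β (i + I + 1) ^ 2) := by
        refine ENNReal.tsum_le_tsum fun i => ?_
        rw [← ENNReal.ofReal_mul (by positivity)]
        refine ENNReal.ofReal_le_ofReal ?_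
        rw [← mul_assoc]
        refine le_mul_of_one_le_left (sq_nonneg _) ?_
        -- The base has to be at least `1` for the exponent to grow from `2 γ` to `2 s`.
        have hπ : (1 : ℝ) ≤ Real.pi := by linarith [Real.pi_gt_three]
        have hI1 : (1 : ℝ) ≤ (I : ℝ) + 1 := by linarith [Nat.cast_nonneg (α := ℝ) I]
        have hx : 1 ≤ Real.pi * ((I : ℝ) + 1) := by nlinarith
        have hxy : Real.pi * ((I : ℝ) + 1) ≤ Real.pi * (((i + I : ℕ) : ℝ) + 1) := by
          push_cast
          have := Nat.cast_nonneg (α := ℝ) i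
          gcongr
          linarith
        calc (1 : ℝ) = (Real.pi * ((I : ℝ) + 1)) ^ (-(2 * γ)) *
              (Real.pi * ((I : ℝ) + 1)) ^ (2 * γ) := by
              rw [← Real.rpow_add (by linarith)]
              simp
          _ ≤ (Real.pi * ((I : ℝ) + 1)) ^ (-(2 * γ)) *
              (Real.pi * (((i + I : ℕ) : ℝ) + 1)) ^ (2 * s) := by
              refine mul_le_mul_of_nonneg_left ?_ (by positivity)
              calc _ ≤ (Real.pi * (((i + I : ℕ) : ℝ) + 1)) ^ (2 * γ) :=
                    Real.rpow_le_rpow (by linarith) hxy (by linarith)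
                _ ≤ _ := Real.rpow_le_rpow_of_exponent_le (by linarith) (by linarith)
    _ = ENNReal.ofReal ((Real.pi * ((I : ℝ) + 1)) ^ (-(2 * γ))) * ∑' i : ℕ,
          ENNReal.ofReal ((Real.pi * (((i + I : ℕ) : ℝ) + 1)) ^ (2 * s) * β (i + I + 1) ^ 2) :=
        ENNReal.tsum_mul_left
    _ ≤ ENNReal.ofReal ((Real.pi * ((I : ℝ) + 1)) ^ (-(2 * γ))) * ENNReal.ofReal (c ^ 2) := by
        refine mul_le_mul_right (le_trans ?_ hβ) _
        exact ENNReal.tsum_comp_le_tsum_of_injective (add_left_injective I)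
          fun i : ℕ => ENNReal.ofReal ((Real.pi * ((i : ℝ) + 1)) ^ (2 * s) * β (i + 1) ^ 2)

section Hilbert

variable {E : Type*} [NormedAddCommGroup E] [InnerProductSpace ℝ E]

lemma inner_hilbertBasis_sum_range (b : HilbertBasis ℕ ℝ E) (a : ℕ → ℝ) (n i : ℕ) :
    inner ℝ (b i) (∑ j ∈ Finset.range n, a j • b j) = if i ∈ Finset.range n then a i else 0 := by
  rw [inner_sum]
  simp_rw [inner_smul_right, orthonormal_iff_ite.1 b.orthonormal]
  simp

/-- The coefficients in `sobolevClass` are only asserted to exist; this identifies them with the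
Fourier coefficients. The `i`-th inner product with a partial sum is constant once `n > i`. -/
lemma inner_hilbertBasis_eq_of_tendsto (b : HilbertBasis ℕ ℝ E) {β : ℕ → ℝ} {G : E}
    (h : Tendsto (fun n => ∑ j ∈ Finset.range n, β j • b j) atTop (𝓝 G)) (i : ℕ) :
    inner ℝ (b i) G = β i := by
  have h1 : Tendsto (fun n => inner ℝ (b i) (∑ j ∈ Finset.range n, β j • b j)) atTop
      (𝓝 (inner ℝ (b i) G)) := tendsto_const_nhds.inner h
  refine tendsto_nhds_unique h1 (tendsto_const_nhds.congr' ?_)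
  filter_upwards [eventually_gt_atTop i] with n hn
  rw [inner_hilbertBasis_sum_range, if_pos (Finset.mem_range.2 hn)]

/-- Parseval for the difference, whose coefficients from `n` on are those of `-G`. -/
lemma ofReal_norm_sq_sum_sub (b : HilbertBasis ℕ ℝ E) (a : ℕ → ℝ) (G : E) (n : ℕ) :
    ENNReal.ofReal (‖∑ j ∈ Finset.range n, a j • b j - G‖ ^ 2)
      = ∑ j ∈ Finset.range n, ENNReal.ofReal ((a j - inner ℝ (b j) G) ^ 2)
        + ∑' j, ENNReal.ofReal ((inner ℝ (b (j + n)) G) ^ 2) := by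
  set v : E := ∑ j ∈ Finset.range n, a j • b j - G with hv
  have hsum : HasSum (fun i => (inner ℝ (b i) v) ^ 2) (‖v‖ ^ 2) := by
    have := b.hasSum_inner_mul_inner v v
    rw [real_inner_self_eq_norm_sq] at this
    simpa only [real_inner_comm, ← sq] using this
  rw [← hsum.tsum_eq, ENNReal.ofReal_tsum_of_nonneg (fun i => sq_nonneg _) hsum.summable,
    ← Summable.sum_add_tsum_nat_add' (k := n) ENNReal.summable]
  congr 1
  · refine Finset.sum_congr rfl fun i hi => ?_
    rw [hv, inner_sub_right, inner_hilbertBasis_sum_range, if_pos hi]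
  · refine tsum_congr fun i => ?_
    rw [hv, inner_sub_right, inner_hilbertBasis_sum_range, if_neg (by simp), zero_sub, neg_sq]

end Hilbert

lemma coeFn_sum_range_smul {b : ℕ → Lp ℝ 2 (volume.restrict D)}
    (hb : ∀ i, (b i : ℝ → ℝ) =ᵐ[volume.restrict D] φ i) (a : ℕ → ℝ) (n : ℕ) :
    ((∑ i ∈ Finset.range n, a i • b i : Lp ℝ 2 (volume.restrict D)) : ℝ → ℝ)
      =ᵐ[volume.restrict D] fun y => ∑ i ∈ Finset.range n, a i * φ i y := by
  induction n with
  | zero => simpa using! Lp.coeFn_zero ℝ 2 (volume.restrict D)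
  | succ n ih =>
    rw [Finset.sum_range_succ]
    filter_upwards [Lp.coeFn_add (∑ i ∈ Finset.range n, a i • b i) (a n • b n), ih,
      Lp.coeFn_smul (a n) (b n), hb n] with y h1 h2 h3 h4
    rw [h1, Pi.add_apply, h2, h3, Pi.smul_apply, h4, Finset.sum_range_succ, smul_eq_mul]

/-- Parseval bound for the integrated squared error of a truncated series estimate. -/
lemma lintegral_sq_sub_le (hφ : IsOrthonormalBasisL2 D φ) {g : ℝ → ℝ} {s c γ : ℝ} (hγ : 0 < γ)
    (hs : γ ≤ s) (hg : g ∈ sobolevClass D φ s c) (a : ℕ → ℝ) (I : ℕ) :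
    ∫⁻ y in D, ENNReal.ofReal ((∑ i ∈ Finset.range (I + 1), a i * φ i y - g y) ^ 2)
      ≤ ∑ i ∈ Finset.range (I + 1), ENNReal.ofReal ((a i - ∫ y in D, g y * φ i y) ^ 2)
        + ENNReal.ofReal ((Real.pi * ((I : ℝ) + 1)) ^ (-(2 * γ))) * ENNReal.ofReal (c ^ 2) := by
  obtain ⟨hφm, b, hb⟩ := id hφ
  obtain ⟨hg2, β, hβlim, hβsum⟩ := hg
  obtain ⟨G, hGg⟩ : ∃ G : Lp ℝ 2 (volume.restrict D), (G : ℝ → ℝ) =ᵐ[volume.restrict D] g :=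
    ⟨hg2.toLp g, hg2.coeFn_toLp⟩
  have hcoef : ∀ i, inner ℝ (b i) G = ∫ y in D, g y * φ i y := by
    intro i
    rw [L2.inner_def]
    refine integral_congr_ae ?_
    filter_upwards [hGg, hb i] with y h1 h2
    rw [h1, h2]
    simp
  have hβ : ∀ i, inner ℝ (b i) G = β i := by
    refine inner_hilbertBasis_eq_of_tendsto b ?_
    rw [tendsto_iff_edist_tendsto_0]
    refine hβlim.congr fun n => ?_
    rw [edist_comm, Lp.edist_def]
    refine eLpNorm_congr_ae ?_
    filter_upwards [hGg, coeFn_sum_range_smul hb β n] with y h1 h2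
    rw [Pi.sub_apply, h1, h2]
  have hvae : ((∑ i ∈ Finset.range (I + 1), a i • b i - G : Lp ℝ 2 (volume.restrict D)) : ℝ → ℝ)
      =ᵐ[volume.restrict D] fun y => ∑ i ∈ Finset.range (I + 1), a i * φ i y - g y := by
    filter_upwards [Lp.coeFn_sub (∑ i ∈ Finset.range (I + 1), a i • b i) G,
      coeFn_sum_range_smul hb a (I + 1), hGg] with y h1 h2 h3
    rw [h1, Pi.sub_apply, h2, h3]
  rw [lintegral_ofReal_sq_eq _ hvae, ofReal_norm_sq_sum_sub]
  simp_rw [← hcoef]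
  refine add_le_add le_rfl ?_
  simp_rw [hβ]
  exact tsum_ofReal_sq_le hγ hs hβsum I

end L2

end FlexCodeTS

namespace FlexCodeTS

/-! ### Conditional densities and conditional means at regular points. -/

section CondDensity

variable {d : ℕ}

/-- The points of `K` at which `f u` is a probability density on `D` that lives on `𝒴`. -/
def IsRegularPoint (K : Set (EuclideanSpace ℝ (Fin d))) (𝒴 D : Set ℝ)
    (f : EuclideanSpace ℝ (Fin d) → ℝ → ℝ) (u : EuclideanSpace ℝ (Fin d)) : Prop :=
  u ∈ K ∧ ∫⁻ y in D, ENNReal.ofReal (f u y) = 1 ∧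
    ∀ᵐ y ∂(volume.restrict D), y ∉ 𝒴 → ENNReal.ofReal (f u y) = 0

variable {Ω : Type*} [MeasurableSpace Ω] {μ : Measure Ω}
  {U : Ω → EuclideanSpace ℝ (Fin d)} {Y : Ω → ℝ} {K : Set (EuclideanSpace ℝ (Fin d))}
  {𝒴 D : Set ℝ} {f : EuclideanSpace ℝ (Fin d) → ℝ → ℝ}

lemma IsCondDensity.measure_mem_mem [IsProbabilityMeasure μ]
    (hf : IsCondDensity μ U Y K D f) (hU : Measurable U)
    (hY : Measurable Y) {A : Set (EuclideanSpace ℝ (Fin d))} {S : Set ℝ} (hA : MeasurableSet A)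
    (hS : MeasurableSet S) :
    μ {ω | U ω ∈ A ∧ Y ω ∈ S} = ∫⁻ u in A,
      ∫⁻ y in S, ENNReal.ofReal (f u y) ∂(volume.restrict D) ∂(μ.map U) := by
  have h1 : μ {ω | U ω ∈ A ∧ Y ω ∈ S} = μ.map (fun ω => (U ω, Y ω)) (A ×ˢ S) := by
    rw [Measure.map_apply (hU.prodMk hY) (hA.prod hS)]
    rfl
  have hm : IsProbabilityMeasure (μ.map U) := Measure.isProbabilityMeasure_map hU.aemeasurable
  rw [h1, hf.2.2, withDensity_apply _ (hA.prod hS), ← Measure.prod_restrict,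
    lintegral_prod _ (by exact hf.1.ennreal_ofReal.aemeasurable)]

/-- The joint law constrains `f u` only for almost every `u`. Comparing the masses of `A × ℝ` for
all `A` gives total mass one; the null event `Y ∉ 𝒴` gives the support. -/
lemma IsCondDensity.ae_isRegularPoint [IsProbabilityMeasure μ]
    (hf : IsCondDensity μ U Y K D f) (hU : Measurable U)
    (hY : Measurable Y) (h𝒴 : MeasurableSet 𝒴) (hUK : ∀ᵐ ω ∂μ, U ω ∈ K)
    (hK : MeasurableSet K) (hY𝒴 : ∀ᵐ ω ∂μ, Y ω ∈ 𝒴) :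
    ∀ᵐ u ∂(μ.map U), IsRegularPoint K 𝒴 D f u := by
  have hm : IsProbabilityMeasure (μ.map U) := Measure.isProbabilityMeasure_map hU.aemeasurable
  have hf2 : Measurable fun p : EuclideanSpace ℝ (Fin d) × ℝ => ENNReal.ofReal (f p.1 p.2) :=
    hf.1.ennreal_ofReal
  have h1 : ∀ᵐ u ∂(μ.map U), u ∈ K := (ae_map_iff hU.aemeasurable hK).2 hUK
  have h2 : (fun u => ∫⁻ y in D, ENNReal.ofReal (f u y)) =ᵐ[μ.map U] fun _ => 1 := by
    refine ae_eq_of_forall_setLIntegral_eq_of_sigmaFinite hf2.lintegral_prod_right'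
      measurable_const fun A hA _ => ?_
    have := hf.measure_mem_mem hU hY hA MeasurableSet.univ
    rw [Measure.restrict_univ] at this
    rw [← this, setLIntegral_const, one_mul, Measure.map_apply hU hA]
    simp
    rfl
  have h3 : ∀ᵐ u ∂(μ.map U), ∫⁻ y in 𝒴ᶜ, ENNReal.ofReal (f u y) ∂(volume.restrict D) = 0 := by
    have := hf.measure_mem_mem hU hY MeasurableSet.univ h𝒴.compl
    rw [Measure.restrict_univ] at this
    refine (lintegral_eq_zero_iff hf2.lintegral_prod_right').1 (this.symm.trans ?_)
    refine measure_mono_null ?_ hY𝒴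
    intro ω hω
    exact hω.2
  filter_upwards [h1, h2, h3] with u hu1 hu2 hu3
  refine ⟨hu1, hu2, ?_⟩
  have hfu : Measurable fun y => ENNReal.ofReal (f u y) := hf2.comp measurable_prodMk_left
  rw [lintegral_eq_zero_iff hfu] at hu3
  exact (ae_restrict_iff' h𝒴.compl).1 hu3

lemma IsRegularPoint.integrable {u : EuclideanSpace ℝ (Fin d)} (hu : IsRegularPoint K 𝒴 D f u)
    (hf : IsCondDensity μ U Y K D f) (hD : MeasurableSet D) :
    Integrable (f u) (volume.restrict D) ∧ ∫ y in D, f u y = 1 := by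
  have hfu : Measurable (f u) := hf.1.comp measurable_prodMk_left
  have h0 : 0 ≤ᵐ[volume.restrict D] f u :=
    (ae_restrict_iff' hD).2 (ae_of_all _ fun y hy => hf.2.1 u hu.1 y hy)
  refine ⟨⟨hfu.aestronglyMeasurable, ?_⟩, ?_⟩
  · rw [hasFiniteIntegral_iff_ofReal h0, hu.2.1]
    exact ENNReal.one_lt_top
  · rw [integral_eq_lintegral_of_nonneg_ae h0 hfu.aestronglyMeasurable, hu.2.1, ENNReal.toReal_one]

lemma IsRegularPoint.ae_eq_zero {u : EuclideanSpace ℝ (Fin d)} (hu : IsRegularPoint K 𝒴 D f u)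
    (hf : IsCondDensity μ U Y K D f) (hD : MeasurableSet D) :
    ∀ᵐ y ∂(volume.restrict D), y ∉ 𝒴 → f u y = 0 := by
  filter_upwards [hu.2.2, ae_restrict_mem hD] with y hy hyD hy𝒴
  exact le_antisymm (ENNReal.ofReal_eq_zero.1 (hy hy𝒴)) (hf.2.1 u hu.1 y hyD)

/-- The conditional mean of `ψ(Y)` given `U = u`, clipped to `[-M, M]`. -/
def condMean (D : Set ℝ) (f : EuclideanSpace ℝ (Fin d) → ℝ → ℝ) (ψ : ℝ → ℝ) (M : ℝ)
    (u : EuclideanSpace ℝ (Fin d)) : ℝ :=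
  max (-M) (min M (∫ y in D, f u y * ψ y))

lemma abs_condMean_le {M : ℝ} (hM : 0 ≤ M) (ψ : ℝ → ℝ) (u : EuclideanSpace ℝ (Fin d)) :
    |condMean D f ψ M u| ≤ M :=
  abs_le.2 ⟨le_max_left _ _, max_le (by linarith) (min_le_left _ _)⟩

lemma measurable_condMean (hf : Measurable (Function.uncurry f)) {ψ : ℝ → ℝ} (hψ : Measurable ψ)
    (M : ℝ) : Measurable (condMean D f ψ M) := by
  have h : StronglyMeasurable fun p : EuclideanSpace ℝ (Fin d) × ℝ => f p.1 p.2 * ψ p.2 :=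
    (Measurable.mul (by exact hf) (hψ.comp measurable_snd)).stronglyMeasurable
  exact measurable_const.max (measurable_const.min h.integral_prod_right'.measurable)

variable {ψ : ℝ → ℝ} {M : ℝ}

lemma IsRegularPoint.integrable_mul {u : EuclideanSpace ℝ (Fin d)}
    (hu : IsRegularPoint K 𝒴 D f u) (hf : IsCondDensity μ U Y K D f) (hD : MeasurableSet D)
    (hψ : Measurable ψ) (hψM : ∀ y, |ψ y| ≤ M) :
    Integrable (fun y => f u y * ψ y) (volume.restrict D) :=
  (hu.integrable hf hD).1.mul_bdd (c := M) hψ.aestronglyMeasurable (ae_of_all _ hψM)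

/-- Clipping is void where `f u` is a probability density. Elsewhere it keeps `condMean` bounded by
`M`, so that the residuals are bounded everywhere. -/
lemma IsRegularPoint.condMean_eq {u : EuclideanSpace ℝ (Fin d)}
    (hu : IsRegularPoint K 𝒴 D f u) (hf : IsCondDensity μ U Y K D f) (hD : MeasurableSet D)
    (hψM : ∀ y, |ψ y| ≤ M) : condMean D f ψ M u = ∫ y in D, f u y * ψ y := by
  have h : |∫ y in D, f u y * ψ y| ≤ M := by
    obtain ⟨hi, h1⟩ := hu.integrable hf hD
    calc |∫ y in D, f u y * ψ y| ≤ ∫ y in D, f u y * M := by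
          rw [← Real.norm_eq_abs]
          refine norm_integral_le_of_norm_le (hi.mul_const M) ?_
          filter_upwards [ae_restrict_mem hD] with y hy
          rw [Real.norm_eq_abs, abs_mul, abs_of_nonneg (hf.2.1 u hu.1 y hy)]
          exact mul_le_mul_of_nonneg_left (hψM y) (hf.2.1 u hu.1 y hy)
      _ = M := by rw [integral_mul_const, h1, one_mul]
  rw [condMean, min_eq_right (abs_le.1 h).2, max_eq_right (abs_le.1 h).1]

/-- Both densities vanish almost everywhere off `𝒴`, so the pointwise Lipschitz bound is integrated
over a set of finite measure only. The constant depends on `ψ` through `M` alone. -/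
lemma IsRegularPoint.abs_condMean_sub_le {u v : EuclideanSpace ℝ (Fin d)}
    (hu : IsRegularPoint K 𝒴 D f u) (hv : IsRegularPoint K 𝒴 D f v)
    (hf : IsCondDensity μ U Y K D f) (hD : MeasurableSet D) (h𝒴 : MeasurableSet 𝒴)
    (h𝒴bdd : Bornology.IsBounded 𝒴) (hψ : Measurable ψ) (hψM : ∀ y, |ψ y| ≤ M) {M₀ : ℝ}
    (hM₀ : 0 ≤ M₀)
    (hLip : ∀ y ∈ 𝒴, ∀ u₁ ∈ K, ∀ u₂ ∈ K, |f u₁ y - f u₂ y| ≤ M₀ * ‖u₁ - u₂‖) :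
    |condMean D f ψ M u - condMean D f ψ M v|
      ≤ M₀ * M * (volume.restrict D).real 𝒴 * ‖u - v‖ := by
  have hfin : (volume.restrict D) 𝒴 ≠ ∞ :=
    ((Measure.restrict_apply_le _ _).trans_lt h𝒴bdd.measure_lt_top).ne
  rw [hu.condMean_eq hf hD hψM, hv.condMean_eq hf hD hψM,
    ← integral_sub (hu.integrable_mul hf hD hψ hψM) (hv.integrable_mul hf hD hψ hψM),
    ← Real.norm_eq_abs]
  refine (norm_integral_le_of_norm_le
    (g := 𝒴.indicator fun _ => M₀ * ‖u - v‖ * M) ?_ ?_).trans (le_of_eq ?_)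
  · exact (integrable_indicator_iff h𝒴).2 (integrableOn_const hfin)
  · filter_upwards [hu.ae_eq_zero hf hD, hv.ae_eq_zero hf hD] with y h1 h2
    by_cases hy : y ∈ 𝒴
    · rw [Set.indicator_of_mem hy, ← sub_mul, Real.norm_eq_abs, abs_mul]
      exact mul_le_mul (hLip y hy u hu.1 v hv.1) (hψM y) (abs_nonneg _) (by positivity)
    · rw [Set.indicator_of_notMem hy, h1 hy, h2 hy]
      simp
  · rw [integral_indicator_const _ h𝒴, smul_eq_mul]
    ring

/-- The residuals `ψ(Y) - E[ψ(Y) | U]` are orthogonal to the events of `U`. -/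
lemma IsCondDensity.integral_indicator_sub_condMean [IsProbabilityMeasure μ]
    (hf : IsCondDensity μ U Y K D f)
    (hU : Measurable U) (hY : Measurable Y) (hD : MeasurableSet D)
    (hreg : ∀ᵐ u ∂(μ.map U), IsRegularPoint K 𝒴 D f u)
    (hψ : Measurable ψ) (hM : 0 ≤ M) (hψM : ∀ y, |ψ y| ≤ M)
    {A : Set (EuclideanSpace ℝ (Fin d))} (hA : MeasurableSet A) :
    ∫ ω, A.indicator (fun u => ψ (Y ω) - condMean D f ψ M u) (U ω) ∂μ = 0 := by
  have hm : IsProbabilityMeasure (μ.map U) := Measure.isProbabilityMeasure_map hU.aemeasurable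
  have hb := measurable_condMean (D := D) hf.1 hψ M
  have hψ2 : Measurable fun p : EuclideanSpace ℝ (Fin d) × ℝ =>
      A.indicator (fun _ => ψ p.2) p.1 :=
    (hψ.comp measurable_snd).indicator (measurable_fst hA)
  have hbound : ∀ p : EuclideanSpace ℝ (Fin d) × ℝ, ‖A.indicator (fun _ => ψ p.2) p.1‖ ≤ M :=
    fun p => (norm_indicator_le_norm_self _ _).trans (hψM _)
  have hbi : Integrable (fun u => A.indicator (condMean D f ψ M) u) (μ.map U) :=
    Integrable.of_bound (hb.indicator hA).aestronglyMeasurable M (ae_of_all _ fun u =>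
      (norm_indicator_le_norm_self _ _).trans (abs_condMean_le hM ψ u))
  have hψi : Integrable (fun p : EuclideanSpace ℝ (Fin d) × ℝ => A.indicator (fun _ => ψ p.2) p.1)
      (μ.map fun ω => (U ω, Y ω)) := by
    have : IsProbabilityMeasure (μ.map fun ω => (U ω, Y ω)) :=
      Measure.isProbabilityMeasure_map (hU.prodMk hY).aemeasurable
    exact Integrable.of_bound hψ2.aestronglyMeasurable M (ae_of_all _ hbound)
  have h1 : ∫ ω, A.indicator (fun _ => ψ (Y ω)) (U ω) ∂μ
      = ∫ u, A.indicator (condMean D f ψ M) u ∂(μ.map U) := by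
    have e1 : ∫ ω, A.indicator (fun _ => ψ (Y ω)) (U ω) ∂μ
        = ∫ p, A.indicator (fun _ => ψ p.2) p.1 ∂(μ.map fun ω => (U ω, Y ω)) :=
      (integral_map (hU.prodMk hY).aemeasurable hψ2.aestronglyMeasurable).symm
    have hfm : Measurable fun p : EuclideanSpace ℝ (Fin d) × ℝ => ENNReal.ofReal (f p.1 p.2) :=
      hf.1.ennreal_ofReal
    have hi := hψi
    rw [hf.2.2, integrable_withDensity_iff_integrable_smul' hfm
      (ae_of_all _ fun _ => ENNReal.ofReal_lt_top)] at hi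
    rw [e1, hf.2.2, integral_withDensity_eq_integral_toReal_smul hfm
      (ae_of_all _ fun _ => ENNReal.ofReal_lt_top), integral_prod _ hi]
    refine integral_congr_ae ?_
    filter_upwards [hreg] with u hu
    by_cases huA : u ∈ A
    · rw [Set.indicator_of_mem huA, hu.condMean_eq hf hD hψM]
      refine integral_congr_ae ?_
      filter_upwards [ae_restrict_mem hD] with y hy
      rw [Set.indicator_of_mem huA, smul_eq_mul,
        ENNReal.toReal_ofReal (hf.2.1 u hu.1 y hy)]
    · simp [huA]
  have h2 : ∫ ω, A.indicator (condMean D f ψ M) (U ω) ∂μ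
      = ∫ u, A.indicator (condMean D f ψ M) u ∂(μ.map U) :=
    (integral_map hU.aemeasurable (hb.indicator hA).aestronglyMeasurable).symm
  have h3 : ∀ ω, A.indicator (fun u => ψ (Y ω) - condMean D f ψ M u) (U ω)
      = A.indicator (fun _ => ψ (Y ω)) (U ω) - A.indicator (condMean D f ψ M) (U ω) := fun ω => by
    by_cases h : U ω ∈ A <;> simp [h]
  simp_rw [h3]
  rw [integral_sub, h1, h2, sub_self]
  · exact hψi.comp_measurable (hU.prodMk hY)
  · exact hbi.comp_measurable hU

end CondDensity

end FlexCodeTS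

namespace FlexCodeTS

open ProbabilityTheory

/-! ### Stationarity, mixing and second moments of local sums. -/

section Dependence

variable {S : Type*} [MeasurableSpace S]

lemma measurable_pastSigma {Ω : Type*} {Z : ℕ → Ω → S} {n i : ℕ} (hi : i ≤ n) :
    Measurable[pastSigma Z n] (Z i) :=
  (comap_measurable (Z i)).mono
    (le_iSup₂ (f := fun i (_ : i ≤ n) => MeasurableSpace.comap (Z i) inferInstance) i hi) le_rfl

lemma measurable_futureSigma {Ω : Type*} {Z : ℕ → Ω → S} {n i : ℕ} (hi : n ≤ i) :
    Measurable[futureSigma Z n] (Z i) :=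
  (comap_measurable (Z i)).mono
    (le_iSup₂ (f := fun i (_ : n ≤ i) => MeasurableSpace.comap (Z i) inferInstance) i hi) le_rfl

variable {Ω : Type*} [MeasurableSpace Ω] {μ : Measure Ω} {Z : ℕ → Ω → S}

lemma IsStationary.map_pair (hst : IsStationary μ Z) (hZ : ∀ t, Measurable (Z t)) (j k : ℕ) :
    μ.map (fun ω => (Z j ω, Z (j + k) ω)) = μ.map (fun ω => (Z 0 ω, Z k ω)) := by
  have hm : Measurable fun z : ℕ → S => (z 0, z k) :=
    (measurable_pi_apply 0).prodMk (measurable_pi_apply k)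
  have h := congrArg (Measure.map fun z : ℕ → S => (z 0, z k)) (hst j)
  rw [Measure.map_map hm (measurable_pi_lambda _ fun i => hZ _),
    Measure.map_map hm (measurable_pi_lambda _ fun i => hZ _)] at h
  simpa [Function.comp_def, add_comm] using h

lemma IsStationary.map_eq (hst : IsStationary μ Z) (hZ : ∀ t, Measurable (Z t)) (j : ℕ) :
    μ.map (Z j) = μ.map (Z 0) := by
  have h := congrArg (Measure.map Prod.fst) (hst.map_pair hZ j 0)
  rwa [Measure.map_map measurable_fst ((hZ _).prodMk (hZ _)),
    Measure.map_map measurable_fst ((hZ _).prodMk (hZ _))] at h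

lemma abs_measureReal_inter_sub_le_alphaMixingCoeff [IsProbabilityMeasure μ] {n k : ℕ} {A B : Set Ω}
    (hA : MeasurableSet[pastSigma Z n] A) (hB : MeasurableSet[futureSigma Z (n + k)] B) :
    |μ.real (A ∩ B) - μ.real A * μ.real B| ≤ alphaMixingCoeff μ Z k := by
  -- A real `sSup` dominates its set only if the set is bounded above; here `1` is a bound.
  refine le_csSup ⟨1, ?_⟩ ⟨n, A, B, hA, hB, rfl⟩
  rintro x ⟨_, A, B, _, _, rfl⟩
  have hA0 := measureReal_nonneg (μ := μ) (s := A)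
  have hB0 := measureReal_nonneg (μ := μ) (s := B)
  have hAB0 := measureReal_nonneg (μ := μ) (s := A ∩ B)
  have hA1 := measureReal_le_one (μ := μ) (s := A)
  have hB1 := measureReal_le_one (μ := μ) (s := B)
  have hAB1 := measureReal_le_one (μ := μ) (s := A ∩ B)
  rw [abs_le]
  constructor <;> nlinarith

/-- The rate is split as `r ^ k * r ^ k` with `r = √ρ`: one factor is later traded for the
probability of a visit, the other makes the covariances summable. -/
lemma IsGeometricallyAlphaMixing.exists_bound (h : IsGeometricallyAlphaMixing μ Z) :
    ∃ r C : ℝ, 0 < r ∧ r < 1 ∧ 0 ≤ C ∧ ∀ k, alphaMixingCoeff μ Z k ≤ C * (r ^ k) ^ 2 := by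
  obtain ⟨ρ, h0, h1, hO⟩ := h
  obtain ⟨C, hC, hb⟩ := bound_of_isBigO_nat_atTop hO
  refine ⟨√ρ, C, Real.sqrt_pos.2 h0, (Real.sqrt_lt' one_pos).2 (by simpa using h1), hC.le,
    fun k => ?_⟩
  have := hb (x := k) (pow_pos h0 k).ne'
  rw [Real.norm_eq_abs, Real.norm_eq_abs, abs_of_pos (pow_pos h0 k)] at this
  rw [← pow_mul, mul_comm k 2, pow_mul, Real.sq_sqrt h0.le]
  exact (le_abs_self _).trans this

/-- Covariances of functions supported in `B`, from mixing and a bound on the joint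
probabilities of visits to `B`. -/
lemma abs_covariance_comp_le [IsProbabilityMeasure μ] (hZ : ∀ t, Measurable (Z t)) (hst : IsStationary μ Z)
    {r C C' : ℝ} (hr0 : 0 < r) (hC : 0 ≤ C) (hC' : 0 ≤ C')
    (hα : ∀ k, alphaMixingCoeff μ Z k ≤ C * (r ^ k) ^ 2)
    {B : Set S} (hB : MeasurableSet B)
    (hpair : ∀ k, 1 ≤ k → μ.real {ω | Z 0 ω ∈ B ∧ Z k ω ∈ B} ≤ C' * μ.real {ω | Z 0 ω ∈ B} ^ 2)
    {g : S → ℝ} (hg : Measurable g) {G : ℝ} (hG : 0 < G)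
    (hgB : ∀ z, |g z| ≤ B.indicator (fun _ => G) z) (j k : ℕ) :
    |cov[fun ω => g (Z j ω), fun ω => g (Z (j + k) ω); μ]|
      ≤ G ^ 2 * (4 * C + C' + 2) * μ.real {ω | Z 0 ω ∈ B} * r ^ k := by
  set q := μ.real {ω | Z 0 ω ∈ B} with hq
  have hq0 : 0 ≤ q := measureReal_nonneg
  have hq1 : q ≤ 1 := measureReal_le_one
  have hgG : ∀ z, |g z| ≤ G := fun z => (hgB z).trans (Set.indicator_le_self' (fun _ _ => hG.le) z)
  have hgm : ∀ t, Measurable fun ω => g (Z t ω) := fun t => hg.comp (hZ t)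
  have hL : ∀ t, MemLp (fun ω => g (Z t ω)) 2 μ := fun t =>
    memLp_two_of_abs_le (hgm t) fun ω => hgG _
  have hBt : ∀ t, MeasurableSet {ω | Z t ω ∈ B} := fun t => hZ t hB
  have hqt : ∀ t, μ.real {ω | Z t ω ∈ B} = q := fun t => by
    have := congrArg (fun ν : Measure S => ν.real B) (hst.map_eq hZ t)
    simp only [map_measureReal_apply (hZ _) hB] at this
    exact this
  have hE : ∀ t, |∫ ω, g (Z t ω) ∂μ| ≤ G * q := fun t => by
    rw [← Real.norm_eq_abs]
    refine (norm_integral_le_of_norm_le (g := {ω | Z t ω ∈ B}.indicator fun _ => G)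
      ((integrable_const G).indicator (hBt t)) (ae_of_all _ fun ω => hgB (Z t ω))).trans ?_
    rw [integral_indicator_const _ (hBt t), hqt, smul_eq_mul, mul_comm]
  have hjoint : μ.real {ω | Z j ω ∈ B ∧ Z (j + k) ω ∈ B} = μ.real {ω | Z 0 ω ∈ B ∧ Z k ω ∈ B} := by
    have := congrArg (fun ν : Measure (S × S) => ν.real (B ×ˢ B)) (hst.map_pair hZ j k)
    simp only [map_measureReal_apply ((hZ _).prodMk (hZ _)) (hB.prod hB)] at this
    exact this
  have hEE : |∫ ω, g (Z j ω) * g (Z (j + k) ω) ∂μ| ≤ G ^ 2 * μ.real {ω | Z 0 ω ∈ B ∧ Z k ω ∈ B} := by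
    have hm : MeasurableSet {ω | Z j ω ∈ B ∧ Z (j + k) ω ∈ B} := (hBt j).inter (hBt (j + k))
    rw [← Real.norm_eq_abs]
    refine (norm_integral_le_of_norm_le
      (g := {ω | Z j ω ∈ B ∧ Z (j + k) ω ∈ B}.indicator fun _ => G ^ 2)
      ((integrable_const _).indicator hm) (ae_of_all _ fun ω => ?_)).trans ?_
    · rw [norm_mul]
      have h1 := hgB (Z j ω)
      have h2 := hgB (Z (j + k) ω)
      by_cases hj : Z j ω ∈ B
      · by_cases hk : Z (j + k) ω ∈ B
        · rw [Set.indicator_of_mem (by exact ⟨hj, hk⟩), sq]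
          exact mul_le_mul (hgG _) (hgG _) (norm_nonneg _) hG.le
        · rw [Set.indicator_of_notMem hk] at h2
          rw [Set.indicator_of_notMem (fun h => hk h.2), abs_nonpos_iff.1 h2]
          simp
      · rw [Set.indicator_of_notMem hj] at h1
        rw [Set.indicator_of_notMem (fun h => hj h.1), abs_nonpos_iff.1 h1]
        simp
    · rw [integral_indicator_const _ hm, hjoint, smul_eq_mul, mul_comm]
  have hcov1 : |cov[fun ω => g (Z j ω), fun ω => g (Z (j + k) ω); μ]|
      ≤ G ^ 2 * μ.real {ω | Z 0 ω ∈ B ∧ Z k ω ∈ B} + (G * q) * (G * q) := by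
    rw [covariance_eq_sub (hL j) (hL (j + k))]
    refine (abs_sub _ _).trans (add_le_add hEE ?_)
    rw [abs_mul]
    exact mul_le_mul (hE j) (hE _) (abs_nonneg _) (by positivity)
  have hG2 : 0 < G ^ 2 := by positivity
  -- At lag zero the pair bound is unavailable, but the joint probability is `q` itself.
  rcases Nat.eq_zero_or_pos k with rfl | hk
  · have h0 : μ.real {ω | Z 0 ω ∈ B ∧ Z 0 ω ∈ B} = q := by simp [hq]
    rw [h0] at hcov1
    refine hcov1.trans ?_
    rw [pow_zero, mul_one, mul_assoc (G ^ 2)]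
    calc G ^ 2 * q + G * q * (G * q) = G ^ 2 * (q + q * q) := by ring
      _ ≤ G ^ 2 * ((4 * C + C' + 2) * q) := by
        refine mul_le_mul_of_nonneg_left ?_ hG2.le
        nlinarith [mul_nonneg hC hq0, mul_nonneg hC' hq0]
  · have hrk : 0 < r ^ k := pow_pos hr0 k
    -- Short lags have `q ≤ r ^ k`, and the pair bound of order `q ^ 2` suffices; long lags have `r
    -- ^ k ≤ q`, and the mixing bound of order `(r ^ k) ^ 2` suffices.
    rcases le_total q (r ^ k) with hqr | hqr
    · refine hcov1.trans ?_
      have h1 := mul_le_mul_of_nonneg_left (hpair k hk) hG2.le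
      have h2 : q * q ≤ q * r ^ k := mul_le_mul_of_nonneg_left hqr hq0
      have h3 : 0 ≤ q * r ^ k := mul_nonneg hq0 hrk.le
      calc _ ≤ G ^ 2 * ((C' + 1) * (q * q)) := by linarith
        _ ≤ G ^ 2 * ((4 * C + C' + 2) * (q * r ^ k)) := by
          refine mul_le_mul_of_nonneg_left ?_ hG2.le
          nlinarith [mul_nonneg hC h3, mul_nonneg hC' h3, mul_le_mul_of_nonneg_left h2 hC']
        _ = _ := by ring
    · have hle1 : pastSigma Z j ≤ (inferInstance : MeasurableSpace Ω) :=
        iSup₂_le fun i _ => (hZ i).comap_le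
      have hle2 : futureSigma Z (j + k) ≤ (inferInstance : MeasurableSpace Ω) :=
        iSup₂_le fun i _ => (hZ i).comap_le
      have h := abs_covariance_le_of_bounded hle1 hle2
        (fun A B hA hB => abs_measureReal_inter_sub_le_alphaMixingCoeff (μ := μ) hA hB)
        (hg.comp (measurable_pastSigma le_rfl)) (hg.comp (measurable_futureSigma le_rfl))
        hG (fun ω => hgG (Z j ω)) (fun ω => hgG (Z (j + k) ω))
      refine (le_of_eq_of_le rfl h).trans ?_
      have h2 : r ^ k * r ^ k ≤ q * r ^ k := mul_le_mul_of_nonneg_right hqr hrk.le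
      have h3 : 0 ≤ q * r ^ k := mul_nonneg hq0 hrk.le
      calc 4 * G ^ 2 * alphaMixingCoeff μ Z k ≤ 4 * G ^ 2 * (C * (r ^ k) ^ 2) :=
            mul_le_mul_of_nonneg_left (hα k) (by positivity)
        _ = G ^ 2 * (4 * C * (r ^ k * r ^ k)) := by ring
        _ ≤ G ^ 2 * ((4 * C + C' + 2) * (q * r ^ k)) := by
          refine mul_le_mul_of_nonneg_left ?_ hG2.le
          nlinarith [mul_nonneg hC h3, mul_nonneg hC' h3, mul_le_mul_of_nonneg_left h2 hC]
        _ = _ := by ring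

/-- Second moment of a centred sum of functions supported in `B`. -/
lemma lintegral_sum_sub_sq_le [IsProbabilityMeasure μ] (hZ : ∀ t, Measurable (Z t)) (hst : IsStationary μ Z)
    {r C C' : ℝ} (hr0 : 0 < r) (hr1 : r < 1) (hC : 0 ≤ C) (hC' : 0 ≤ C')
    (hα : ∀ k, alphaMixingCoeff μ Z k ≤ C * (r ^ k) ^ 2)
    {B : Set S} (hB : MeasurableSet B)
    (hpair : ∀ k, 1 ≤ k → μ.real {ω | Z 0 ω ∈ B ∧ Z k ω ∈ B} ≤ C' * μ.real {ω | Z 0 ω ∈ B} ^ 2)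
    {g : S → ℝ} (hg : Measurable g) {G : ℝ} (hG : 0 < G)
    (hgB : ∀ z, |g z| ≤ B.indicator (fun _ => G) z) (T : ℕ) :
    ∫⁻ ω, ENNReal.ofReal ((∑ j ∈ Finset.Icc 1 T, g (Z j ω) - T * ∫ ω, g (Z 0 ω) ∂μ) ^ 2) ∂μ
      ≤ ENNReal.ofReal
        (G ^ 2 * ((4 * C + C' + 2) * (2 / (1 - r))) * μ.real {ω | Z 0 ω ∈ B} * T) := by
  have hgG : ∀ z, |g z| ≤ G := fun z => (hgB z).trans (Set.indicator_le_self' (fun _ _ => hG.le) z)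
  have hgm : ∀ t, Measurable fun ω => g (Z t ω) := fun t => hg.comp (hZ t)
  have hL : ∀ t, MemLp (fun ω => g (Z t ω)) 2 μ := fun t =>
    memLp_two_of_abs_le (hgm t) fun ω => hgG _
  have hmean : ∀ t, ∫ ω, g (Z t ω) ∂μ = ∫ ω, g (Z 0 ω) ∂μ := fun t => by
    have := congrArg (fun ν : Measure S => ∫ z, g z ∂ν) (hst.map_eq hZ t)
    simpa only [integral_map (hZ _).aemeasurable hg.aestronglyMeasurable] using this
  have hsum : MemLp (fun ω => ∑ j ∈ Finset.Icc 1 T, g (Z j ω)) 2 μ :=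
    memLp_finsetSum _ fun j _ => hL j
  have hEsum : ∫ ω, ∑ j ∈ Finset.Icc 1 T, g (Z j ω) ∂μ = T * ∫ ω, g (Z 0 ω) ∂μ := by
    rw [integral_finsetSum _ fun j _ => (hL j).integrable one_le_two]
    simp [hmean]
  have hvar := variance_sum_le hL (A := G ^ 2 * (4 * C + C' + 2) * μ.real {ω | Z 0 ω ∈ B})
    (by positivity) hr0 hr1
    (fun j k => abs_covariance_comp_le hZ hst hr0 hC hC' hα hB hpair hg hG hgB j k) T
  rw [variance_eq_integral hsum.aestronglyMeasurable.aemeasurable, hEsum] at hvar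
  rw [← ofReal_integral_eq_lintegral_ofReal _ (ae_of_all _ fun ω => sq_nonneg _)]
  · refine ENNReal.ofReal_le_ofReal (hvar.trans (le_of_eq ?_))
    ring
  · exact (hsum.sub (memLp_const _)).integrable_sq

end Dependence

/-! ### Joint visits under bounded densities. -/

section Densities

variable {Ω : Type*} [MeasurableSpace Ω] {μ : Measure Ω} [IsProbabilityMeasure μ] {d : ℕ}
  {U : ℕ → Ω → EuclideanSpace ℝ (Fin d)} {K : Set (EuclideanSpace ℝ (Fin d))}

/-- Joint visits to a set have at most the order of the squared probability of a visit. -/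
lemma HasBoundedDensities.exists_pair_bound (h : HasBoundedDensities μ U K)
    (hU : ∀ t, Measurable (U t)) (hK : MeasurableSet K) (hUK : ∀ᵐ ω ∂μ, U 0 ω ∈ K) :
    ∃ C : ℝ, 0 ≤ C ∧ ∀ B, MeasurableSet B → ∀ k, 1 ≤ k →
      μ.real {ω | U 0 ω ∈ B ∧ U k ω ∈ B} ≤ C * μ.real {ω | U 0 ω ∈ B} ^ 2 := by
  obtain ⟨m, M, hm, ⟨g, hg, hgm, hg0⟩, hh⟩ := h
  have hm0 : ENNReal.ofReal m ≠ 0 := (ENNReal.ofReal_pos.2 hm).ne'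
  refine ⟨(ENNReal.ofReal M / ENNReal.ofReal m).toReal, ENNReal.toReal_nonneg,
    fun B hB k hk => ?_⟩
  obtain ⟨f, hf, hfb, hf0⟩ := hh k hk
  have hP : IsProbabilityMeasure (μ.map (U 0)) :=
    Measure.isProbabilityMeasure_map (hU 0).aemeasurable
  -- The lower bound `m` on the density of `U 0` converts volume into probability; the upper bound
  -- `M` on the conditional density then yields the factor `M / m`.
  have hvol : (volume.restrict K) B ≤ μ.map (U 0) B / ENNReal.ofReal m := by
    rw [ENNReal.le_div_iff_mul_le (Or.inl hm0) (Or.inl ENNReal.ofReal_ne_top), hg0,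
      withDensity_apply _ hB, mul_comm, ← setLIntegral_const]
    refine setLIntegral_mono_ae hg.ennreal_ofReal.aemeasurable ?_
    filter_upwards [ae_restrict_mem hK] with u hu _
    exact ENNReal.ofReal_le_ofReal (hgm u hu).1
  have hjoint : μ {ω | U 0 ω ∈ B ∧ U k ω ∈ B}
      ≤ ENNReal.ofReal M / ENNReal.ofReal m * μ.map (U 0) B ^ 2 := by
    have h1 : μ {ω | U 0 ω ∈ B ∧ U k ω ∈ B} = μ.map (fun ω => (U 0 ω, U k ω)) (B ×ˢ B) := by
      rw [Measure.map_apply ((hU 0).prodMk (hU k)) (hB.prod hB)]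
      rfl
    have hKP : ∀ᵐ u ∂(μ.map (U 0)), u ∈ K := (ae_map_iff (hU 0).aemeasurable hK).2 hUK
    rw [h1, hf0, withDensity_apply _ (hB.prod hB), ← Measure.prod_restrict,
      lintegral_prod _ (by exact hf.ennreal_ofReal.aemeasurable)]
    calc ∫⁻ u in B, ∫⁻ v in B, ENNReal.ofReal (f u v) ∂(volume.restrict K) ∂(μ.map (U 0))
        ≤ ∫⁻ u in B, ENNReal.ofReal M * (μ.map (U 0) B / ENNReal.ofReal m) ∂(μ.map (U 0)) := by
          refine setLIntegral_mono_ae measurable_const.aemeasurable ?_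
          filter_upwards [hKP] with u hu _
          calc ∫⁻ v in B, ENNReal.ofReal (f u v) ∂(volume.restrict K)
              ≤ ∫⁻ v in B, ENNReal.ofReal M ∂(volume.restrict K) := by
                refine setLIntegral_mono_ae measurable_const.aemeasurable ?_
                filter_upwards [ae_restrict_mem hK] with v hv _
                exact ENNReal.ofReal_le_ofReal (hfb u hu v hv).2
            _ ≤ _ := by
                rw [setLIntegral_const]
                exact mul_le_mul_right hvol _
      _ = ENNReal.ofReal M / ENNReal.ofReal m * μ.map (U 0) B ^ 2 := by
          rw [setLIntegral_const, div_eq_mul_inv, div_eq_mul_inv]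
          ring
  have hB0 : μ.map (U 0) B = μ {ω | U 0 ω ∈ B} := Measure.map_apply (hU 0) hB
  rw [hB0] at hjoint
  rw [measureReal_def, measureReal_def, ← ENNReal.toReal_pow, ← ENNReal.toReal_mul]
  refine ENNReal.toReal_mono ?_ hjoint
  exact ENNReal.mul_ne_top (ENNReal.div_ne_top ENNReal.ofReal_ne_top hm0)
    (ENNReal.pow_ne_top (measure_ne_top _ _))

end Densities

end FlexCodeTS

namespace FlexCodeTS

/-! ### Mean squared error of the local average. -/

section Estimate

/-- Deterministic error bound for a weighted average. -/
lemma sq_div_sub_le {ι : Type*} (J : Finset ι) {w y b : ι → ℝ} {b₀ M L s : ℝ}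
    (hw : ∀ j ∈ J, 0 ≤ w j) (hy : ∀ j ∈ J, |y j| ≤ M) (hb₀ : |b₀| ≤ M)
    (hb : ∀ j ∈ J, w j ≠ 0 → |b j - b₀| ≤ L) (hs : 0 < s) :
    ((∑ j ∈ J, w j * y j) / (∑ j ∈ J, w j) - b₀) ^ 2
      ≤ 2 * L ^ 2 + 8 / s ^ 2 * (∑ j ∈ J, w j * (y j - b j)) ^ 2
        + 16 * M ^ 2 / s ^ 2 * (∑ j ∈ J, w j - s) ^ 2 := by
  set N := ∑ j ∈ J, w j with hN
  have hN0 : 0 ≤ N := Finset.sum_nonneg hw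
  have hM : 0 ≤ M := (abs_nonneg _).trans hb₀
  set W := ∑ j ∈ J, w j * (y j - b j) with hW
  have hs2 : 0 < s ^ 2 := by positivity
  have hsum : ∀ (z : ι → ℝ) (c : ℝ), (∀ j ∈ J, w j ≠ 0 → |z j| ≤ c) →
      |∑ j ∈ J, w j * z j| ≤ N * c := by
    intro z c hz
    rw [hN, Finset.sum_mul]
    refine (Finset.abs_sum_le_sum_abs _ _).trans (Finset.sum_le_sum fun j hj => ?_)
    rw [abs_mul, abs_of_nonneg (hw j hj)]
    rcases eq_or_ne (w j) 0 with h0 | h0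
    · simp [h0]
    · exact mul_le_mul_of_nonneg_left (hz j hj h0) (hw j hj)
  -- With `N ≥ s / 2` the error splits into noise `W / N` and a bias of at most `L`. Otherwise the
  -- error is at most `2 M`, also when `N = 0` and the quotient is `0`, and the deviation `|N - s| >
  -- s / 2` pays for it.
  rcases le_or_gt (s / 2) N with h | h
  · have hNpos : 0 < N := by linarith
    have e : (∑ j ∈ J, w j * y j) / N - b₀ = W / N + (∑ j ∈ J, w j * (b j - b₀)) / N := by
      rw [← add_div, hW, ← Finset.sum_add_distrib, eq_div_iff hNpos.ne', sub_mul,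
        div_mul_cancel₀ _ hNpos.ne', hN, Finset.mul_sum, ← Finset.sum_sub_distrib]
      exact Finset.sum_congr rfl fun j _ => by ring
    have h2 : |(∑ j ∈ J, w j * (b j - b₀)) / N| ≤ L := by
      rw [abs_div, abs_of_pos hNpos, div_le_iff₀ hNpos, mul_comm]
      exact hsum _ _ hb
    have h2' : ((∑ j ∈ J, w j * (b j - b₀)) / N) ^ 2 ≤ L ^ 2 := by
      rw [← sq_abs]
      exact pow_le_pow_left₀ (abs_nonneg _) h2 2
    have h1 : (W / N) ^ 2 ≤ 4 / s ^ 2 * W ^ 2 := by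
      rw [div_pow, div_eq_mul_inv, mul_comm]
      refine mul_le_mul_of_nonneg_right ?_ (sq_nonneg W)
      rw [inv_le_comm₀ (by positivity) (by positivity), inv_div]
      nlinarith
    rw [e]
    have h3 : 0 ≤ 16 * M ^ 2 / s ^ 2 * (N - s) ^ 2 := by positivity
    have h4 : 8 / s ^ 2 * W ^ 2 = 2 * (4 / s ^ 2 * W ^ 2) := by ring
    rw [h4]
    nlinarith [sq_nonneg (W / N - (∑ j ∈ J, w j * (b j - b₀)) / N)]
  · have hβ : |(∑ j ∈ J, w j * y j) / N| ≤ M := by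
      rcases hN0.eq_or_lt with h0 | h0
      · rw [← h0, div_zero, abs_zero]
        exact hM
      · rw [abs_div, abs_of_pos h0, div_le_iff₀ h0, mul_comm]
        exact hsum _ _ fun j hj _ => hy j hj
    have h1 : ((∑ j ∈ J, w j * y j) / N - b₀) ^ 2 ≤ (2 * M) ^ 2 := by
      rw [← sq_abs]
      exact pow_le_pow_left₀ (abs_nonneg _) ((abs_sub _ _).trans (by linarith)) 2
    have h2 : s ^ 2 / 4 ≤ (N - s) ^ 2 := by nlinarith
    have h3 : (2 * M) ^ 2 ≤ 16 * M ^ 2 / s ^ 2 * (N - s) ^ 2 := by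
      calc (2 * M) ^ 2 = 16 * M ^ 2 / s ^ 2 * (s ^ 2 / 4) := by field_simp; ring
        _ ≤ _ := mul_le_mul_of_nonneg_left h2 (by positivity)
    have h4 : 0 ≤ 8 / s ^ 2 * W ^ 2 := by positivity
    nlinarith [sq_nonneg L]

variable {Ω : Type*} [MeasurableSpace Ω] {μ : Measure Ω} [IsProbabilityMeasure μ] {d : ℕ}
  {U : ℕ → Ω → EuclideanSpace ℝ (Fin d)} {Y : ℕ → Ω → ℝ} {K : Set (EuclideanSpace ℝ (Fin d))}
  {𝒴 D : Set ℝ} {f : EuclideanSpace ℝ (Fin d) → ℝ → ℝ}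

lemma measurable_nwEstimate {φ : ℕ → ℝ → ℝ} {i : ℕ} (hU : ∀ t, Measurable (U t))
    (hY : ∀ t, Measurable (Y t)) (hφ : Measurable (φ i)) (δ : ℝ) (T : ℕ) :
    Measurable fun p : Ω × EuclideanSpace ℝ (Fin d) =>
      nwEstimate φ δ T (fun j => U j p.1) (fun j => Y j p.1) i p.2 := by
  have hw : ∀ j, Measurable fun p : Ω × EuclideanSpace ℝ (Fin d) =>
      if ‖U j p.1 - p.2‖ ≤ δ then (1 : ℝ) else 0 := fun j =>
    Measurable.ite (measurableSet_le (((hU j).comp measurable_fst).sub measurable_snd).norm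
      measurable_const) measurable_const measurable_const
  unfold nwEstimate
  refine Measurable.div ?_ ?_
  · refine Finset.measurable_sum _ fun j _ => Measurable.mul ?_
      (hφ.comp ((hY j).comp measurable_fst))
    convert hw j
  · refine Finset.measurable_sum _ fun j _ => ?_
    convert hw j

/-- Mean squared error of the local average at a regular point. -/
lemma lintegral_sq_nwEstimate_sub_le (hU : ∀ t, Measurable (U t)) (hY : ∀ t, Measurable (Y t))
    (hst : IsStationary μ (fun t ω => (U t ω, Y t ω)))
    {r C C' : ℝ} (hr0 : 0 < r) (hr1 : r < 1) (hC : 0 ≤ C) (hC' : 0 ≤ C')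
    (hα : ∀ k, alphaMixingCoeff μ (fun t ω => (U t ω, Y t ω)) k ≤ C * (r ^ k) ^ 2)
    (hpair : ∀ B, MeasurableSet B → ∀ k, 1 ≤ k →
      μ.real {ω | U 0 ω ∈ B ∧ U k ω ∈ B} ≤ C' * μ.real {ω | U 0 ω ∈ B} ^ 2)
    (hD : MeasurableSet D) (hf : IsCondDensity μ (U 0) (Y 0) K D f)
    (hreg : ∀ᵐ u ∂(μ.map (U 0)), IsRegularPoint K 𝒴 D f u)
    {ψ : ℝ → ℝ} (hψ : Measurable ψ) {M : ℝ} (hM : 0 < M) (hψM : ∀ y, |ψ y| ≤ M)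
    {L : ℝ} (hL : 0 ≤ L) (hLip : ∀ u v, IsRegularPoint K 𝒴 D f u → IsRegularPoint K 𝒴 D f v →
      |condMean D f ψ M u - condMean D f ψ M v| ≤ L * ‖u - v‖)
    {φ : ℕ → ℝ → ℝ} {i : ℕ} (hφψ : ∀ t, ∀ᵐ ω ∂μ, φ i (Y t ω) = ψ (Y t ω))
    {v : EuclideanSpace ℝ (Fin d)} (hv : IsRegularPoint K 𝒴 D f v) {δ : ℝ} (hδ : 0 < δ)
    {T : ℕ} (hT : 1 ≤ T) :
    ∫⁻ ω, ENNReal.ofReal ((nwEstimate φ δ T (fun j => U j ω) (fun j => Y j ω) i v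
        - condMean D f ψ M v) ^ 2) ∂μ
      ≤ ENNReal.ofReal (2 * L ^ 2 * δ ^ 2)
        + ENNReal.ofReal (48 * M ^ 2 * ((4 * C + C' + 2) * (2 / (1 - r))) / T)
          * (μ.map (U 0) (Metric.closedBall v δ))⁻¹ := by
  set V : ℝ := (4 * C + C' + 2) * (2 / (1 - r)) with hV
  have hVpos : 0 < V := by
    have : 0 < 1 - r := by linarith
    positivity
  have hTpos : (0 : ℝ) < T := by exact_mod_cast hT
  set A : Set (EuclideanSpace ℝ (Fin d)) := Metric.closedBall v δ with hA
  have hAm : MeasurableSet A := Metric.isClosed_closedBall.measurableSet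
  set p : ℝ := μ.real {ω | U 0 ω ∈ A} with hp
  have hpA : μ.map (U 0) A = ENNReal.ofReal p := by
    rw [Measure.map_apply (hU 0) hAm, hp, ofReal_measureReal]
    rfl
  have hpnn : 0 ≤ p := measureReal_nonneg
  -- A ball of mass zero makes the right-hand side infinite.
  rcases hpnn.eq_or_lt with hp0 | hp0
  · rw [hpA, ← hp0, ENNReal.ofReal_zero, ENNReal.inv_zero, ENNReal.mul_top]
    · simp
    · exact (ENNReal.ofReal_pos.2 (by positivity)).ne'
  -- The expected number of visits to the ball.
  set s : ℝ := T * p with hs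
  have hs0 : 0 < s := by positivity
  set Z : ℕ → Ω → EuclideanSpace ℝ (Fin d) × ℝ := fun t ω => (U t ω, Y t ω) with hZdef
  have hZ : ∀ t, Measurable (Z t) := fun t => (hU t).prodMk (hY t)
  set B : Set (EuclideanSpace ℝ (Fin d) × ℝ) := Prod.fst ⁻¹' A with hB
  have hBm : MeasurableSet B := measurable_fst hAm
  have hb := measurable_condMean (D := D) hf.1 hψ M
  -- `g₁` counts visits; `g₂` is the residual on a visit, which has mean zero and is bounded by `2
  -- M`.
  set g₁ : EuclideanSpace ℝ (Fin d) × ℝ → ℝ := B.indicator fun _ => 1 with hg₁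
  set g₂ : EuclideanSpace ℝ (Fin d) × ℝ → ℝ :=
    B.indicator fun z => ψ z.2 - condMean D f ψ M z.1 with hg₂
  have hg₁m : Measurable g₁ := measurable_const.indicator hBm
  have hg₂m : Measurable g₂ :=
    ((hψ.comp measurable_snd).sub (hb.comp measurable_fst)).indicator hBm
  have hpairB : ∀ k, 1 ≤ k → μ.real {ω | Z 0 ω ∈ B ∧ Z k ω ∈ B} ≤ C' * μ.real {ω | Z 0 ω ∈ B} ^ 2 :=
    fun k hk => hpair A hAm k hk
  have hE₁ : ∫ ω, g₁ (Z 0 ω) ∂μ = p := by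
    have : (fun ω => g₁ (Z 0 ω)) = {ω | U 0 ω ∈ A}.indicator fun _ => (1 : ℝ) := rfl
    have hm : MeasurableSet {ω | U 0 ω ∈ A} := hU 0 hAm
    rw [this]
    exact (integral_indicator_const _ hm).trans (by rw [smul_eq_mul, mul_one])
  have hE₂ : ∫ ω, g₂ (Z 0 ω) ∂μ = 0 :=
    hf.integral_indicator_sub_condMean (hU 0) (hY 0) hD hreg hψ hM.le hψM hAm
  have hI₁ := lintegral_sum_sub_sq_le hZ hst hr0 hr1 hC hC' hα hBm hpairB hg₁m one_pos
    (fun z => by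
      by_cases hz : z ∈ B <;> simp [hg₁, hz]) T
  have hI₂ := lintegral_sum_sub_sq_le hZ hst hr0 hr1 hC hC' hα hBm hpairB hg₂m
    (by positivity : 0 < 2 * M)
    (fun z => by
      by_cases hz : z ∈ B
      · rw [hg₂, Set.indicator_of_mem hz, Set.indicator_of_mem hz]
        refine (abs_sub _ _).trans ?_
        linarith [hψM z.2, abs_condMean_le (D := D) (f := f) hM.le ψ z.1]
      · rw [hg₂, Set.indicator_of_notMem hz, Set.indicator_of_notMem hz, abs_zero]) T
  rw [hE₁, ← hV] at hI₁
  rw [hE₂, mul_zero, ← hV] at hI₂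
  simp only [sub_zero] at hI₂
  have hregt : ∀ t, ∀ᵐ ω ∂μ, IsRegularPoint K 𝒴 D f (U t ω) := fun t => by
    have h1 : μ.map (U t) = μ.map (U 0) := by
      have := congrArg (Measure.map Prod.fst) (hst.map_eq hZ t)
      rwa [Measure.map_map measurable_fst (hZ _), Measure.map_map measurable_fst (hZ _)] at this
    rw [← h1] at hreg
    exact ae_of_ae_map (hU t).aemeasurable hreg
  have hpt : ∀ᵐ ω ∂μ, ENNReal.ofReal ((nwEstimate φ δ T (fun j => U j ω) (fun j => Y j ω) i v
        - condMean D f ψ M v) ^ 2)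
      ≤ ENNReal.ofReal (2 * L ^ 2 * δ ^ 2)
        + ENNReal.ofReal (8 / s ^ 2) * ENNReal.ofReal ((∑ j ∈ Finset.Icc 1 T, g₂ (Z j ω)) ^ 2)
        + ENNReal.ofReal (16 * M ^ 2 / s ^ 2) *
          ENNReal.ofReal ((∑ j ∈ Finset.Icc 1 T, g₁ (Z j ω) - s) ^ 2) := by
    filter_upwards [ae_all_iff.2 hregt, ae_all_iff.2 hφψ] with ω h1 h2
    have key := sq_div_sub_le (Finset.Icc 1 T) (w := fun j => g₁ (Z j ω)) (y := fun j => ψ (Y j ω))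
      (b := fun j => condMean D f ψ M (U j ω)) (b₀ := condMean D f ψ M v) (M := M) (L := L * δ)
      (s := s) (fun j _ => Set.indicator_nonneg (fun _ _ => zero_le_one) _) (fun j _ => hψM _)
      (abs_condMean_le hM.le ψ v) (fun j _ hj => by
        have hj' : U j ω ∈ A := by
          by_contra hc
          exact hj (Set.indicator_of_notMem (by exact hc) _)
        refine (hLip _ _ (h1 j) hv).trans (mul_le_mul_of_nonneg_left ?_ hL)
        rwa [hA, Metric.mem_closedBall, dist_eq_norm] at hj') hs0
    rw [← ENNReal.ofReal_mul (by positivity), ← ENNReal.ofReal_mul (by positivity),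
      ← ENNReal.ofReal_add (by positivity) (by positivity),
      ← ENNReal.ofReal_add (by positivity) (by positivity)]
    refine ENNReal.ofReal_le_ofReal (le_trans (le_of_eq ?_) (key.trans (le_of_eq ?_)))
    · have hw : ∀ j, (if ‖U j ω - v‖ ≤ δ then (1 : ℝ) else 0) = g₁ (Z j ω) := fun j => by
        have hiff : Z j ω ∈ B ↔ ‖U j ω - v‖ ≤ δ := by
          rw [hB, Set.mem_preimage, hA, Metric.mem_closedBall, dist_eq_norm]
        by_cases h : ‖U j ω - v‖ ≤ δ
        · rw [if_pos h, hg₁, Set.indicator_of_mem (hiff.2 h)]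
        · rw [if_neg h, hg₁, Set.indicator_of_notMem (fun hc => h (hiff.1 hc))]
      unfold nwEstimate
      congr 3
      · refine Finset.sum_congr rfl fun j _ => ?_
        rw [← hw j, h2 j]
    · have hW : ∀ j, g₁ (Z j ω) * (ψ (Y j ω) - condMean D f ψ M (U j ω)) = g₂ (Z j ω) := fun j => by
        by_cases hz : Z j ω ∈ B
        · rw [hg₁, hg₂, Set.indicator_of_mem hz, Set.indicator_of_mem hz, one_mul]
        · rw [hg₁, hg₂, Set.indicator_of_notMem hz, Set.indicator_of_notMem hz, zero_mul]
      simp_rw [hW]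
      ring
  have hm₁ : Measurable fun ω => ENNReal.ofReal ((∑ j ∈ Finset.Icc 1 T, g₁ (Z j ω) - s) ^ 2) :=
    (((Finset.measurable_sum _ fun j _ => hg₁m.comp (hZ j)).sub_const s).pow_const 2).ennreal_ofReal
  have hm₂ : Measurable fun ω => ENNReal.ofReal ((∑ j ∈ Finset.Icc 1 T, g₂ (Z j ω)) ^ 2) :=
    ((Finset.measurable_sum _ fun j _ => hg₂m.comp (hZ j)).pow_const 2).ennreal_ofReal
  refine (lintegral_mono_ae hpt).trans ?_
  rw [lintegral_add_right _ (hm₁.const_mul _), lintegral_add_right _ (hm₂.const_mul _),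
    lintegral_const_mul _ hm₁, lintegral_const_mul _ hm₂, lintegral_const, measure_univ, mul_one,
    add_assoc]
  refine add_le_add le_rfl ?_
  refine (add_le_add (mul_le_mul_right hI₂ _) (mul_le_mul_right hI₁ _)).trans (le_of_eq ?_)
  rw [hpA, ← ENNReal.ofReal_inv_of_pos hp0, ← ENNReal.ofReal_mul (by positivity),
    ← ENNReal.ofReal_mul (by positivity), ← ENNReal.ofReal_mul (by positivity),
    ← ENNReal.ofReal_add (by positivity) (by positivity)]
  have hpB : μ.real {ω | Z 0 ω ∈ B} = p := rfl
  -- The constant is `48 = 8 * 2 ^ 2 + 16`, from the bounds `2 M` on `g₂` and `1` on `g₁`.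
  rw [hpB, hs]
  congr 1
  field_simp
  ring

end Estimate

end FlexCodeTS

namespace FlexCodeTS

/-! ### Balancing bias, variance and truncation. -/

section Rates

lemma isTheta_exists_bounds {u v : ℕ → ℝ} (h : u =Θ[atTop] v) (hu : ∀ n, 0 ≤ u n)
    (hv : ∀ n, 0 ≤ v n) :
    ∃ c₁ c₂ : ℝ, 0 < c₁ ∧ 0 < c₂ ∧ ∀ᶠ n in atTop, c₁ * v n ≤ u n ∧ u n ≤ c₂ * v n := by
  obtain ⟨c₂, hc₂, h₂⟩ := h.1.exists_pos
  obtain ⟨c₁, hc₁, h₁⟩ := h.2.exists_pos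
  refine ⟨c₁⁻¹, c₂, inv_pos.2 hc₁, hc₂, ?_⟩
  filter_upwards [h₁.bound, h₂.bound] with n hn₁ hn₂
  rw [Real.norm_of_nonneg (hu n), Real.norm_of_nonneg (hv n)] at hn₁ hn₂
  exact ⟨by rwa [inv_mul_le_iff₀ hc₁], hn₂⟩

/-- With the stated bandwidth and cutoff, squared bias, variance and truncation error are all of
the order of the rate. -/
lemma exists_rate_bounds {d : ℕ} {γ : ℝ} (hγ : 0 < γ) {δ : ℕ → ℝ} (hδpos : ∀ T, 0 < δ T)
    (hδ : δ =Θ[atTop] (fun T : ℕ => (T : ℝ) ^ (-(1 / (2 + (d : ℝ)))))) {I : ℕ → ℕ}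
    (hI : (fun T : ℕ => (I T : ℝ)) =Θ[atTop]
      (fun T : ℕ => (T : ℝ) ^ (2 / ((2 * γ + 1) * (2 + (d : ℝ)))))) :
    ∃ R C : ℝ, 0 < C ∧ ∀ᶠ T : ℕ in atTop, δ T ≤ R ∧
      ((I T : ℝ) + 1) * δ T ^ 2
        ≤ C * (T : ℝ) ^ (-(2 * γ) / (2 * γ + 1 + (d : ℝ) * (γ + 1 / 2))) ∧
      ((I T : ℝ) + 1) * (δ T ^ (-(d : ℝ)) / T)
        ≤ C * (T : ℝ) ^ (-(2 * γ) / (2 * γ + 1 + (d : ℝ) * (γ + 1 / 2))) ∧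
      (Real.pi * ((I T : ℝ) + 1)) ^ (-(2 * γ))
        ≤ C * (T : ℝ) ^ (-(2 * γ) / (2 * γ + 1 + (d : ℝ) * (γ + 1 / 2))) := by
  obtain ⟨c₁, c₂, hc₁, hc₂, hδb⟩ := isTheta_exists_bounds hδ (fun T => (hδpos T).le)
    (fun T => by positivity)
  obtain ⟨k₁, k₂, hk₁, hk₂, hIb⟩ := isTheta_exists_bounds hI (fun T => by positivity)
    (fun T => by positivity)
  set e : ℝ := 1 / (2 + (d : ℝ)) with he
  set e₁ : ℝ := 2 / ((2 * γ + 1) * (2 + (d : ℝ))) with he₁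
  set a : ℝ := -(2 * γ) / (2 * γ + 1 + (d : ℝ) * (γ + 1 / 2)) with ha
  have hd0 : (0 : ℝ) ≤ d := Nat.cast_nonneg d
  have hd2 : (0 : ℝ) < 2 + d := by linarith
  have hγ1 : (0 : ℝ) < 2 * γ + 1 := by linarith
  have hden : 2 * γ + 1 + (d : ℝ) * (γ + 1 / 2) = (2 * γ + 1) * (2 + d) / 2 := by ring
  have he0 : 0 ≤ e := by positivity
  have he₁0 : 0 ≤ e₁ := by positivity
  have ha1 : e₁ + -e * 2 = a := by
    rw [ha, hden, he, he₁]
    field_simp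
    ring
  have ha2 : e₁ + (-e * -(d : ℝ) - 1) = a := by
    rw [ha, hden, he, he₁]
    field_simp
    ring
  have ha3 : e₁ * -(2 * γ) = a := by
    rw [ha, hden, he₁]
    field_simp
  -- `R = c₂` works because `T ^ (-e) ≤ 1`. The negative powers of `δ` and `I` call for their lower
  -- constants `c₁` and `k₁`.
  refine ⟨c₂, max ((k₂ + 1) * c₂ ^ 2) (max ((k₂ + 1) * c₁ ^ (-(d : ℝ))) (k₁ ^ (-(2 * γ)))),
    lt_max_of_lt_left (by positivity), ?_⟩
  filter_upwards [hδb, hIb, eventually_ge_atTop 1] with T hδT hIT hT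
  have hT1 : (1 : ℝ) ≤ T := by exact_mod_cast hT
  have hT0 : (0 : ℝ) < T := by linarith
  have hTa : 0 < (T : ℝ) ^ a := Real.rpow_pos_of_pos hT0 a
  have hI1 : (I T : ℝ) + 1 ≤ (k₂ + 1) * (T : ℝ) ^ e₁ := by
    have := Real.one_le_rpow hT1 he₁0
    linarith [hIT.2]
  refine ⟨?_, ?_, ?_, ?_⟩
  · refine hδT.2.trans (mul_le_of_le_one_right hc₂.le ?_)
    exact Real.rpow_le_one_of_one_le_of_nonpos hT1 (by linarith)
  · calc ((I T : ℝ) + 1) * δ T ^ 2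
        ≤ ((k₂ + 1) * (T : ℝ) ^ e₁) * (c₂ * (T : ℝ) ^ (-e)) ^ 2 :=
          mul_le_mul hI1 (pow_le_pow_left₀ (hδpos T).le hδT.2 2) (by positivity) (by positivity)
      _ = (k₂ + 1) * c₂ ^ 2 * (T : ℝ) ^ a := by
          rw [← ha1, Real.rpow_add hT0, Real.rpow_mul hT0.le, Real.rpow_two]
          ring
      _ ≤ _ := mul_le_mul_of_nonneg_right (le_max_left _ _) hTa.le
  · calc ((I T : ℝ) + 1) * (δ T ^ (-(d : ℝ)) / T)
        ≤ ((k₂ + 1) * (T : ℝ) ^ e₁) * ((c₁ * (T : ℝ) ^ (-e)) ^ (-(d : ℝ)) / T) := by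
          refine mul_le_mul hI1 ?_ (by have := hδpos T; positivity) (by positivity)
          refine div_le_div_of_nonneg_right ?_ hT0.le
          exact Real.rpow_le_rpow_of_nonpos (by positivity) hδT.1 (by linarith)
      _ = (k₂ + 1) * c₁ ^ (-(d : ℝ)) * (T : ℝ) ^ a := by
          rw [← ha2, Real.rpow_add hT0, Real.rpow_sub hT0, Real.rpow_mul hT0.le, Real.rpow_one,
            Real.mul_rpow hc₁.le (by positivity)]
          ring
      _ ≤ _ := mul_le_mul_of_nonneg_right
          ((le_max_left _ _).trans (le_max_right _ _)) hTa.le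
  · calc (Real.pi * ((I T : ℝ) + 1)) ^ (-(2 * γ))
        ≤ (k₁ * (T : ℝ) ^ e₁) ^ (-(2 * γ)) := by
          refine Real.rpow_le_rpow_of_nonpos (by positivity) ?_ (by linarith)
          have : (0 : ℝ) ≤ I T := Nat.cast_nonneg _
          nlinarith [hIT.1, Real.pi_gt_three]
      _ = k₁ ^ (-(2 * γ)) * (T : ℝ) ^ a := by
          rw [Real.mul_rpow hk₁.le (by positivity), ← Real.rpow_mul hT0.le, ha3]
      _ ≤ _ := mul_le_mul_of_nonneg_right
          ((le_max_right _ _).trans (le_max_right _ _)) hTa.le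

/-- The ball estimate with `ε = δ / 2`. Fixing the thickening radius `R` gives one constant for all
`δ ≤ R`, finite because `K` is bounded. -/
lemma exists_lintegral_inv_closedBall_bound {d : ℕ} (P : Measure (EuclideanSpace ℝ (Fin d)))
    [IsProbabilityMeasure P] {K : Set (EuclideanSpace ℝ (Fin d))} (hK : ∀ᵐ u ∂P, u ∈ K)
    (hKbdd : Bornology.IsBounded K) (R : ℝ) :
    ∃ W : ℝ, 0 ≤ W ∧ ∀ δ : ℝ, 0 < δ → δ ≤ R →
      ∫⁻ u, (P (Metric.closedBall u δ))⁻¹ ∂P ≤ ENNReal.ofReal (W * δ ^ (-(d : ℝ))) := by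
  set b : ℝ := volume.real (Metric.ball (0 : EuclideanSpace ℝ (Fin d)) 1) with hb
  have hb0 : 0 < b := ENNReal.toReal_pos (Metric.measure_ball_pos volume _ one_pos).ne'
    Metric.isBounded_ball.measure_lt_top.ne
  refine ⟨volume.real (Metric.cthickening R K) / ((1 / 2) ^ d * b), by positivity,
    fun δ hδ hδR => ?_⟩
  have hvol : volume (Metric.closedBall (0 : EuclideanSpace ℝ (Fin d)) (δ / 2))
      = ENNReal.ofReal ((δ / 2) ^ d * b) := by
    rw [Measure.addHaar_closedBall _ _ (by positivity), ENNReal.ofReal_mul (by positivity), hb,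
      ofReal_measureReal Metric.isBounded_ball.measure_lt_top.ne]
    simp
  have hpos : 0 < (δ / 2) ^ d * b := by positivity
  have h := lintegral_inv_measure_closedBall_le volume P hK (ε := δ / 2) (R := R) (by linarith)
    (by rw [hvol]; exact (ENNReal.ofReal_pos.2 hpos).ne') (by rw [hvol]; exact ENNReal.ofReal_ne_top)
  rw [mul_div_cancel₀ _ two_ne_zero, hvol,
    ← ofReal_measureReal (hKbdd.cthickening).measure_lt_top.ne,
    ← ENNReal.ofReal_div_of_pos hpos] at h
  refine h.trans (ENNReal.ofReal_le_ofReal (le_of_eq ?_))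
  rw [Real.rpow_neg hδ.le, Real.rpow_natCast, div_pow, div_pow, one_pow]
  field_simp

end Rates

/-! ### Markov's inequality and the bound on the loss. -/

section Loss

/-- Markov's inequality is applied to the measurable majorant, so measurability of `X T` is never
needed. -/
lemma isBigOP_of_lintegral_le {Ω : Type*} [MeasurableSpace Ω] {μ : Measure Ω}
    {X : ℕ → Ω → ℝ≥0∞} {a : ℕ → ℝ} {C : ℝ} (hC : 0 < C)
    (h : ∀ᶠ T in atTop, 0 < a T ∧ ∃ X' : Ω → ℝ≥0∞, Measurable X' ∧ (∀ᵐ ω ∂μ, X T ω ≤ X' ω) ∧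
      ∫⁻ ω, X' ω ∂μ ≤ ENNReal.ofReal (C * a T)) :
    IsBigOP μ X a := by
  intro ε hε
  refine ⟨C / ε, by positivity, ?_⟩
  filter_upwards [h] with T hT
  obtain ⟨ha, X', hX', hle, hint⟩ := hT
  have hpos : 0 < C / ε * a T := by positivity
  calc μ {ω | ENNReal.ofReal (C / ε * a T) < X T ω}
      ≤ μ {ω | ENNReal.ofReal (C / ε * a T) ≤ X' ω} := by
        refine measure_mono_ae ?_
        filter_upwards [hle] with ω hω hlt
        exact (le_of_lt hlt).trans hω
    _ ≤ (∫⁻ ω, X' ω ∂μ) / ENNReal.ofReal (C / ε * a T) :=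
        meas_ge_le_lintegral_div hX'.aemeasurable (ENNReal.ofReal_pos.2 hpos).ne'
          ENNReal.ofReal_ne_top
    _ ≤ ENNReal.ofReal (C * a T) / ENNReal.ofReal (C / ε * a T) :=
        ENNReal.div_le_div_right hint _
    _ = ENNReal.ofReal ε := by
        rw [← ENNReal.ofReal_div_of_pos hpos]
        congr 1
        field_simp

end Loss

end FlexCodeTS

namespace FlexCodeTS

/-- The loss is bounded by the errors of the estimated coefficients and the truncation error. -/
lemma cdeLoss_flexCodeEstimate_le {d : ℕ} {P : Measure (EuclideanSpace ℝ (Fin d))} {D : Set ℝ}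
    {φ : ℕ → ℝ → ℝ} (hφ : IsOrthonormalBasisL2 D φ) {K : Set (EuclideanSpace ℝ (Fin d))}
    {f : EuclideanSpace ℝ (Fin d) → ℝ → ℝ} {γ : ℝ} (hγ : 0 < γ)
    {s c : EuclideanSpace ℝ (Fin d) → ℝ} (hs : IsGLB (s '' K) γ)
    (hf : ∀ u ∈ K, f u ∈ sobolevClass D φ (s u) (c u))
    (hc : Integrable (fun u => c u ^ 2) P)
    {β : ℕ → EuclideanSpace ℝ (Fin d) → ℝ}
    (hβ : ∀ᵐ u ∂P, u ∈ K ∧ ∀ i, ∫ y in D, f u y * φ i y = β i u)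
    (δ : ℝ) (I T : ℕ) (u : ℕ → EuclideanSpace ℝ (Fin d)) (y : ℕ → ℝ) :
    cdeLoss P D (flexCodeEstimate φ δ I T u y) f
      ≤ ∫⁻ v, ∑ i ∈ Finset.range (I + 1),
          ENNReal.ofReal ((nwEstimate φ δ T u y i v - β i v) ^ 2) ∂P
        + ENNReal.ofReal ((Real.pi * ((I : ℝ) + 1)) ^ (-(2 * γ)) * ∫ v, c v ^ 2 ∂P) := by
  rw [ENNReal.ofReal_mul (by positivity),
    ofReal_integral_eq_lintegral_ofReal hc (ae_of_all _ fun v => sq_nonneg _),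
    ← lintegral_const_mul' _ _ ENNReal.ofReal_ne_top,
    ← lintegral_add_right' _ (hc.aestronglyMeasurable.aemeasurable.ennreal_ofReal.const_mul _)]
  refine lintegral_mono_ae ?_
  filter_upwards [hβ] with v hv
  have h := lintegral_sq_sub_le hφ hγ (hs.1 ⟨v, hv.1, rfl⟩) (hf v hv.1)
    (fun i => nwEstimate φ δ T u y i v) I
  simp_rw [hv.2] at h
  exact h

end FlexCodeTS

end

/-! ### The expected loss and its rate. -/

theorem theorem2 {Ω : Type*} [MeasurableSpace Ω] (μ : Measure Ω) [IsProbabilityMeasure μ]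
    (d : ℕ)
    -- the series
    (U : ℕ → Ω → EuclideanSpace ℝ (Fin d)) (Y : ℕ → Ω → ℝ)
    (hU : ∀ t, Measurable (U t)) (hY : ∀ t, Measurable (Y t))
    -- the ranges of the covariates and of the responses, both bounded
    (K : Set (EuclideanSpace ℝ (Fin d))) (𝒴 : Set ℝ)
    (hK : MeasurableSet K) (h𝒴 : MeasurableSet 𝒴)
    (hKbdd : Bornology.IsBounded K) (h𝒴bdd : Bornology.IsBounded 𝒴)
    (hUK : ∀ t, ∀ᵐ ω ∂μ, U t ω ∈ K) (hY𝒴 : ∀ t, ∀ᵐ ω ∂μ, Y t ω ∈ 𝒴)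
    -- the orthonormal basis of `L²(D)`, for instance with `D = 𝒴` or `D = ℝ`
    (D : Set ℝ) (hD : MeasurableSet D) (h𝒴D : 𝒴 ⊆ D)
    (φ : ℕ → ℝ → ℝ) (hφ : FlexCodeTS.IsOrthonormalBasisL2 D φ)
    (hφbdd : ∃ M : ℝ, 0 < M ∧ ∀ i, ∀ y ∈ 𝒴, |φ i y| < M)
    -- the conditional density and its smoothness
    (f : EuclideanSpace ℝ (Fin d) → ℝ → ℝ)
    (hf : FlexCodeTS.IsCondDensity μ (U 0) (Y 0) K D f)
    (γ : ℝ) (hfy : FlexCodeTS.SmoothInY μ (U 0) K D φ f γ)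
    (hfu : FlexCodeTS.SmoothInU K 𝒴 f)
    -- stationarity, bounded densities, mixing
    (hstat : FlexCodeTS.IsStationary μ (fun t ω => (U t ω, Y t ω)))
    (hdens : FlexCodeTS.HasBoundedDensities μ U K)
    (hmix : FlexCodeTS.IsGeometricallyAlphaMixing μ (fun t ω => (U t ω, Y t ω)))
    -- bandwidth and cutoff
    (δ : ℕ → ℝ) (hδpos : ∀ T, 0 < δ T)
    (hδ : δ =Θ[atTop] (fun T : ℕ => (T : ℝ) ^ (-(1 / (2 + (d : ℝ))))))
    (I : ℕ → ℕ)
    (hI : (fun T : ℕ => (I T : ℝ)) =Θ[atTop]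
      (fun T : ℕ => (T : ℝ) ^ (2 / ((2 * γ + 1) * (2 + (d : ℝ)))))) :
    FlexCodeTS.IsBigOP μ
      (fun T ω => FlexCodeTS.cdeLoss (μ.map (U 0)) D
        (FlexCodeTS.flexCodeEstimate φ (δ T) (I T) T (fun j => U j ω) (fun j => Y j ω)) f)
      (fun T : ℕ => (T : ℝ) ^ (-(2 * γ) / (2 * γ + 1 + (d : ℝ) * (γ + 1 / 2)))) := by
  obtain ⟨M, hM, hφM⟩ := hφbdd
  obtain ⟨hγ, s, c, hs, -, hc, hfs⟩ := hfy
  obtain ⟨M₀, hM₀, hLip⟩ := hfu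
  have hγ0 : 0 < γ := by linarith
  have hP : IsProbabilityMeasure (μ.map (U 0)) :=
    Measure.isProbabilityMeasure_map (hU 0).aemeasurable
  have hreg := hf.ae_isRegularPoint (hU 0) (hY 0) h𝒴 (hUK 0) hK (hY𝒴 0)
  obtain ⟨r, C, hr0, hr1, hC, hα⟩ := hmix.exists_bound
  obtain ⟨C', hC', hpair⟩ := hdens.exists_pair_bound hU hK (hUK 0)
  obtain ⟨R, Cr, hCr, hrate⟩ := FlexCodeTS.exists_rate_bounds hγ0 hδpos hδ hI
  obtain ⟨W, hW, hball⟩ := FlexCodeTS.exists_lintegral_inv_closedBall_bound (μ.map (U 0))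
    ((ae_map_iff (hU 0).aemeasurable hK).2 (hUK 0)) hKbdd R
  -- The basis functions are bounded on `𝒴` only. Cutting them off outside `𝒴` changes neither the
  -- data, almost surely, nor the coefficients of `f u` at regular points.
  set ψ : ℕ → ℝ → ℝ := fun i => 𝒴.indicator (φ i) with hψ
  have hψm : ∀ i, Measurable (ψ i) := fun i => (hφ.1 i).indicator h𝒴
  have hψM : ∀ i y, |ψ i y| ≤ M := fun i y => by
    by_cases hy : y ∈ 𝒴
    · simpa [hψ, hy] using (hφM i y hy).le
    · simpa [hψ, hy] using hM.le
  have hφψ : ∀ i t, ∀ᵐ ω ∂μ, φ i (Y t ω) = ψ i (Y t ω) := fun i t => by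
    filter_upwards [hY𝒴 t] with ω hω
    exact (Set.indicator_of_mem hω (φ i)).symm
  set β : ℕ → EuclideanSpace ℝ (Fin d) → ℝ := fun i => FlexCodeTS.condMean D f (ψ i) M with hβ
  have hβm : ∀ i, Measurable (β i) := fun i => FlexCodeTS.measurable_condMean hf.1 (hψm i) M
  have hβeq : ∀ᵐ u ∂(μ.map (U 0)), u ∈ K ∧ ∀ i, ∫ y in D, f u y * φ i y = β i u := by
    filter_upwards [hreg] with u hu
    refine ⟨hu.1, fun i => ?_⟩
    refine Eq.trans ?_ (hu.condMean_eq hf hD (hψM i)).symm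
    refine integral_congr_ae ?_
    filter_upwards [hu.ae_eq_zero hf hD] with y hy
    by_cases hy𝒴 : y ∈ 𝒴
    · simp only [hψ, Set.indicator_of_mem hy𝒴]
    · rw [hy hy𝒴, zero_mul, zero_mul]
  set L : ℝ := M₀ * M * (volume.restrict D).real 𝒴 with hL
  have hL0 : 0 ≤ L := by positivity
  set Q : ℝ := 48 * M ^ 2 * ((4 * C + C' + 2) * (2 / (1 - r))) with hQ
  have hQ0 : 0 ≤ Q := by
    have : 0 < 1 - r := by linarith
    positivity
  have hEc : 0 ≤ ∫ v, c v ^ 2 ∂(μ.map (U 0)) := integral_nonneg fun v => sq_nonneg _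
  -- The summand `1` keeps the constant positive.
  refine FlexCodeTS.isBigOP_of_lintegral_le
    (C := (2 * L ^ 2 + Q * W + ∫ v, c v ^ 2 ∂(μ.map (U 0)) + 1) * Cr) (by positivity) ?_
  filter_upwards [hrate, eventually_ge_atTop 1] with T hTr hT
  obtain ⟨hδR, hbias, hvar, htail⟩ := hTr
  have hT0 : (0 : ℝ) < T := by exact_mod_cast hT
  set a : ℝ := (T : ℝ) ^ (-(2 * γ) / (2 * γ + 1 + (d : ℝ) * (γ + 1 / 2))) with ha
  have ha0 : 0 < a := Real.rpow_pos_of_pos hT0 _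
  set F : Ω → EuclideanSpace ℝ (Fin d) → ℝ≥0∞ := fun ω v => ∑ i ∈ Finset.range (I T + 1),
    ENNReal.ofReal ((FlexCodeTS.nwEstimate φ (δ T) T (fun j => U j ω) (fun j => Y j ω) i v
      - β i v) ^ 2) with hF
  have hterm : ∀ i, Measurable fun p : Ω × EuclideanSpace ℝ (Fin d) => ENNReal.ofReal
      ((FlexCodeTS.nwEstimate φ (δ T) T (fun j => U j p.1) (fun j => Y j p.1) i p.2
        - β i p.2) ^ 2) := fun i =>
    (((FlexCodeTS.measurable_nwEstimate hU hY (hφ.1 i) (δ T) T).sub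
      ((hβm i).comp measurable_snd)).pow_const 2).ennreal_ofReal
  have hFm : Measurable (Function.uncurry F) := Finset.measurable_sum _ fun i _ => hterm i
  refine ⟨ha0, fun ω => ∫⁻ v, F ω v ∂(μ.map (U 0)) + ENNReal.ofReal
    ((Real.pi * ((I T : ℝ) + 1)) ^ (-(2 * γ)) * ∫ v, c v ^ 2 ∂(μ.map (U 0))),
    hFm.lintegral_prod_right'.add_const _, ae_of_all _ fun ω =>
      FlexCodeTS.cdeLoss_flexCodeEstimate_le hφ hγ0 hs hfs hc hβeq (δ T) (I T) T _ _, ?_⟩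
  -- Tonelli puts the expectation inside, where the error bound at a fixed regular `v` applies.
  rw [lintegral_add_right _ measurable_const, lintegral_const, measure_univ, mul_one,
    lintegral_lintegral_swap hFm.aemeasurable]
  have hpoint : ∀ᵐ v ∂(μ.map (U 0)), ∫⁻ ω, F ω v ∂μ ≤
      ((I T + 1 : ℕ) : ℝ≥0∞) * (ENNReal.ofReal (2 * L ^ 2 * δ T ^ 2) + ENNReal.ofReal (Q / T)
        * (μ.map (U 0) (Metric.closedBall v (δ T)))⁻¹) := by
    filter_upwards [hreg] with v hv
    refine (lintegral_finsetSum _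
      fun i _ => (hterm i).comp measurable_prodMk_right).le.trans ?_
    refine (Finset.sum_le_sum fun i _ =>
      FlexCodeTS.lintegral_sq_nwEstimate_sub_le hU hY hstat hr0 hr1 hC hC' hα hpair hD hf hreg
        (hψm i) hM (hψM i) hL0 (fun u v hu hv => hu.abs_condMean_sub_le hv hf hD h𝒴 h𝒴bdd
          (hψm i) (hψM i) hM₀.le hLip) (hφψ i) hv (hδpos T) hT).trans (le_of_eq ?_)
    rw [Finset.sum_const, Finset.card_range, nsmul_eq_mul]
  have hint : ∫⁻ v, ∫⁻ ω, F ω v ∂μ ∂(μ.map (U 0)) ≤ ((I T + 1 : ℕ) : ℝ≥0∞) *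
      (ENNReal.ofReal (2 * L ^ 2 * δ T ^ 2)
        + ENNReal.ofReal (Q / T) * ENNReal.ofReal (W * δ T ^ (-(d : ℝ)))) := by
    refine (lintegral_mono_ae hpoint).trans ?_
    rw [lintegral_const_mul' _ _ (ENNReal.natCast_ne_top _), lintegral_add_left measurable_const,
      lintegral_const, measure_univ, mul_one, lintegral_const_mul' _ _ ENNReal.ofReal_ne_top]
    exact mul_le_mul_right (add_le_add le_rfl (mul_le_mul_right (hball _ (hδpos T) hδR) _)) _
  refine (add_le_add hint le_rfl).trans ?_
  have hδd : 0 < δ T ^ (-(d : ℝ)) := Real.rpow_pos_of_pos (hδpos T) _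
  rw [← ENNReal.ofReal_natCast, ← ENNReal.ofReal_mul (by positivity),
    ← ENNReal.ofReal_add (by positivity) (by positivity), ← ENNReal.ofReal_mul (by positivity),
    ← ENNReal.ofReal_add (by positivity) (by positivity)]
  refine ENNReal.ofReal_le_ofReal ?_
  push_cast
  have h1 := mul_le_mul_of_nonneg_left hbias (by positivity : 0 ≤ 2 * L ^ 2)
  have h2 := mul_le_mul_of_nonneg_left hvar (by positivity : 0 ≤ Q * W)
  have h3 := mul_le_mul_of_nonneg_right htail hEc
  have h4 : 0 ≤ Cr * a := by positivity
  calc ((I T : ℝ) + 1) * (2 * L ^ 2 * δ T ^ 2 + Q / T * (W * δ T ^ (-(d : ℝ))))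
        + (Real.pi * ((I T : ℝ) + 1)) ^ (-(2 * γ)) * ∫ v, c v ^ 2 ∂(μ.map (U 0))
      = 2 * L ^ 2 * (((I T : ℝ) + 1) * δ T ^ 2)
        + Q * W * (((I T : ℝ) + 1) * (δ T ^ (-(d : ℝ)) / T))
        + (Real.pi * ((I T : ℝ) + 1)) ^ (-(2 * γ)) * ∫ v, c v ^ 2 ∂(μ.map (U 0)) := by ring
    _ ≤ 2 * L ^ 2 * (Cr * a) + Q * W * (Cr * a) + Cr * a * ∫ v, c v ^ 2 ∂(μ.map (U 0)) :=
        add_le_add (add_le_add h1 h2) h3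
    _ ≤ (2 * L ^ 2 + Q * W + ∫ v, c v ^ 2 ∂(μ.map (U 0)) + 1) * Cr * a := by linarith
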